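/- A numerical semigroup is a submonoid $S$ of $(\mathbb{N},+)$, where $\mathbb N=\{0,1,2,\dots\}$, whose complement in $\mathbb{N}$ is finite. Its set of primitives $P(S)$ is the smallest finite set that generates $S$ as a monoid, $e(S)=|P(S)|$ is its embedding dimension, and $\max P(S)$ is its maximum primitive. The Frobenius number $F(S)$ is the largest integer not belonging to $S$ (so $F(\mathbb{N})=-1$), the conductor is $c(S)=F(S)+1$, and $\ell(S)$ is the number of elements of $S$ smaller than $F(S)$. **Theorem.** Let $n\le 60$ be a positive integer. Every numerical semigroup $S$ with maximum primitive $n$ satisfies Wilf's inequality $$e(S)\,\ell(S)\ \ge\ c(S).$$ -/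

import Mathlib

/-- A numerical semigroup: a cofinite submonoid of `(ℕ, +)`. -/
structure NumericalSemigroup extends AddSubmonoid ℕ where
  cofinite : {x : ℕ | x ∉ carrier}.Finite

namespace NumericalSemigroup

/-- The set of primitives (minimal generators) of `S`: the smallest finite set that generates `S`,
written as the intersection of all finite generating sets. It is itself such a set:
see `isLeast_primitives`. -/
def primitives (S : NumericalSemigroup) : Set ℕ :=
  ⋂₀ {A : Set ℕ | A.Finite ∧ AddSubmonoid.closure A = S.toAddSubmonoid}

/-- The embedding dimension `e(S)`: the number of primitives. -/
noncomputable def embeddingDimension (S : NumericalSemigroup) : ℕ :=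
  S.primitives.ncard

/-- The Frobenius number of `S`: the largest integer that does not belong to `S`
(it is `-1` if `S = ℕ`); see `isGreatest_frobenius`. -/
noncomputable def frobenius (S : NumericalSemigroup) : ℤ :=
  sSup {z : ℤ | ∀ s ∈ S.toAddSubmonoid, (s : ℤ) ≠ z}

/-- The conductor `c(S)`: the Frobenius number plus one. -/
noncomputable def conductor (S : NumericalSemigroup) : ℤ :=
  S.frobenius + 1

/-- The left elements of `S`: the elements smaller than the Frobenius number. -/
def leftElements (S : NumericalSemigroup) : Set ℕ :=
  {s : ℕ | s ∈ S.toAddSubmonoid ∧ (s : ℤ) < S.frobenius}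

/-- The number `ℓ(S)` of left elements. -/
noncomputable def numLeft (S : NumericalSemigroup) : ℕ :=
  S.leftElements.ncard

/-- Wilf's inequality `e(S) ℓ(S) ≥ c(S)`. -/
def SatisfiesWilf (S : NumericalSemigroup) : Prop :=
  (S.embeddingDimension : ℤ) * (S.numLeft : ℤ) ≥ S.conductor

/-- The set of numerical semigroups with maximum primitive `n`. -/
def withMaxPrimitive (n : ℕ) : Set NumericalSemigroup :=
  {S | IsGreatest S.primitives n}

theorem exists_bound (S : NumericalSemigroup) :
    ∃ N : ℕ, ∀ x, N < x → x ∈ S.toAddSubmonoid := by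
  obtain ⟨N, hN⟩ := S.cofinite.bddAbove
  refine ⟨N, fun x hx => ?_⟩
  by_contra h
  exact absurd (hN (show x ∈ {x : ℕ | x ∉ S.carrier} from h)) (by omega)

/-- Among the finite sets that generate `S` there is a smallest one, namely `S.primitives`;
and its elements are the nonzero elements of `S` that are not a sum of two nonzero elements. -/
theorem primitives_aux (S : NumericalSemigroup) :
    IsLeast {A : Set ℕ | A.Finite ∧ AddSubmonoid.closure A = S.toAddSubmonoid} S.primitives ∧
    S.primitives = {x : ℕ | x ∈ S.toAddSubmonoid ∧ x ≠ 0 ∧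
      ∀ a ∈ S.toAddSubmonoid, ∀ b ∈ S.toAddSubmonoid, a + b = x → a = 0 ∨ b = 0} := by
  set I : Set ℕ := {x : ℕ | x ∈ S.toAddSubmonoid ∧ x ≠ 0 ∧
      ∀ a ∈ S.toAddSubmonoid, ∀ b ∈ S.toAddSubmonoid, a + b = x → a = 0 ∨ b = 0} with hI
  have hsub : ∀ A : Set ℕ, AddSubmonoid.closure A = S.toAddSubmonoid → I ⊆ A := by
    intro A hA x hx
    have key : ∀ y ∈ AddSubmonoid.closure A, y ∈ I → y ∈ A := by
      intro y hy
      induction hy using AddSubmonoid.closure_induction with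
      | mem y hy => exact fun _ => hy
      | zero => exact fun h => absurd rfl h.2.1
      | add a b ha hb iha ihb =>
        intro h
        rcases h.2.2 a (hA ▸ ha) b (hA ▸ hb) rfl with h0 | h0
        · subst h0
          rw [zero_add] at h ⊢
          exact ihb h
        · subst h0
          rw [add_zero] at h ⊢
          exact iha h
    exact key x (hA ▸ hx.1) hx
  have hfin : I.Finite := by
    obtain ⟨N, hN⟩ := S.exists_bound
    refine (Set.finite_Iic (2 * N + 2)).subset fun x hx => ?_
    by_contra h
    simp only [Set.mem_Iic, not_le] at h
    rcases hx.2.2 (N + 1) (hN _ (by omega)) (x - (N + 1)) (hN _ (by omega)) (by omega) with h | h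
      <;> omega
  have hgen : AddSubmonoid.closure I = S.toAddSubmonoid := by
    apply le_antisymm
    · exact AddSubmonoid.closure_le.2 fun x hx => hx.1
    · intro x
      induction x using Nat.strong_induction_on with
      | _ x ih =>
        intro hx
        by_cases hxI : x ∈ I
        · exact AddSubmonoid.subset_closure hxI
        by_cases h0 : x = 0
        · exact h0 ▸ zero_mem _
        have : ∃ a ∈ S.toAddSubmonoid, ∃ b ∈ S.toAddSubmonoid, a + b = x ∧ a ≠ 0 ∧ b ≠ 0 := by
          by_contra hcon
          push Not at hcon
          exact hxI ⟨hx, h0, fun a ha b hb hab => by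
            by_contra hne
            rw [not_or] at hne
            exact hne.2 (hcon a ha b hb hab hne.1)⟩
        obtain ⟨a, ha, b, hb, hab, ha0, hb0⟩ := this
        rw [← hab]
        exact add_mem (ih a (by omega) ha) (ih b (by omega) hb)
  have heq : S.primitives = I :=
    Set.Subset.antisymm (Set.sInter_subset_of_mem ⟨hfin, hgen⟩)
      (Set.subset_sInter fun A hA => hsub A hA.2)
  rw [heq]
  exact ⟨⟨⟨hfin, hgen⟩, fun A hA => hsub A hA.2⟩, rfl⟩

theorem isLeast_primitives (S : NumericalSemigroup) :
    IsLeast {A : Set ℕ | A.Finite ∧ AddSubmonoid.closure A = S.toAddSubmonoid} S.primitives :=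
  S.primitives_aux.1

theorem mem_primitives_iff (S : NumericalSemigroup) (x : ℕ) :
    x ∈ S.primitives ↔ x ∈ S.toAddSubmonoid ∧ x ≠ 0 ∧
      ∀ a ∈ S.toAddSubmonoid, ∀ b ∈ S.toAddSubmonoid, a + b = x → a = 0 ∨ b = 0 := by
  rw [S.primitives_aux.2]
  rfl

theorem isGreatest_frobenius (S : NumericalSemigroup) :
    IsGreatest {z : ℤ | ∀ s ∈ S.toAddSubmonoid, (s : ℤ) ≠ z} S.frobenius := by
  have hne : {z : ℤ | ∀ s ∈ S.toAddSubmonoid, (s : ℤ) ≠ z}.Nonempty :=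
    ⟨-1, fun s _ => by omega⟩
  have hbdd : BddAbove {z : ℤ | ∀ s ∈ S.toAddSubmonoid, (s : ℤ) ≠ z} := by
    obtain ⟨N, hN⟩ := S.exists_bound
    refine ⟨(N : ℤ), fun z hz => ?_⟩
    by_contra h
    exact hz z.toNat (hN _ (by omega)) (by omega)
  exact ⟨Int.csSup_mem hne hbdd, fun z hz => le_csSup hbdd hz⟩

theorem finite_leftElements (S : NumericalSemigroup) : S.leftElements.Finite :=
  (Set.finite_Iio S.frobenius.toNat).subset fun s hs => by
    have := hs.2
    simp only [Set.mem_Iio]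
    omega

end NumericalSemigroup

/-! Write `cnt T x` for the number of elements of T below x. Since F(S) is not in S, Wilf's
inequality says x ≤ e(S) · `cnt S x` at the single point x = F(S) + 1. It therefore suffices to
prove such a bound for all x above some known gap of S, with e(S) and `cnt S x` replaced by lower
bounds.

Let A be a list of primitives of S containing the smallest one m, let k be its length and T the
submonoid it generates. Three facts turn the problem into a finite search. (1) T + m ⊆ T, so `cnt T
(x + m) - cnt T x` is nondecreasing in x. If x ≤ e · `cnt T x` on one period ending at a multiple N
of m, the bound persists for all larger x (`le_mul_cnt`). (2) If at least r primitives are missing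
from A, then e(S) ≥ k + r. These primitives are at most 60 and lie outside T, so `cnt S x` ≥ `cnt T
x` + r for x > 60 (`satisfiesWilf_of_bound`). (3) If the primitives outside A are all at least q,
then S is contained in the submonoid `upper A q` generated by A and the integers in [q, 60]. Any y
missing from it is a gap of S, so F(S) ≥ y. Let x₁ be the largest x ≤ N at which the bound from (2)
fails. If `upper A q` misses some y with x₁ ≤ y below the block width, every semigroup in the branch
satisfies Wilf's inequality. Otherwise the next primitive is chosen, and the case where it is the
last one is tested directly.

For a fast kernel evaluation, T and its counting function are vectors of fixed-width digits in one
natural number. Adding a generator is a few shifts, prefix sums are one multiplication, and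
comparing all x at once is one subtraction. The lemmas `prefixLanes_laneSet`, `testBit_failLanes`
and `Covers.shiftUp` justify this arithmetic; `scan_sound` and `search_sound` justify the pruning.
-/

namespace WilfSearch

open NumericalSemigroup

/- Wilf's inequality is verified by a search over the sets of primitives in `[1, 60]`, evaluated in
the kernel. Sets of integers and their counting functions are stored as the lanes of large natural
numbers, and the programs use only recursors and the operations on numerals that the kernel
computes natively. -/

/-! ### The programs evaluated by the kernel -/

/-- `∑_{i < L} 2 ^ (b * i)`. -/
noncomputable def ones (b L : ℕ) : ℕ :=
  Nat.div (Nat.sub (Nat.pow 2 (Nat.mul b L)) 1) (Nat.sub (Nat.pow 2 b) 1)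

/-- The bits of `A`, together with their translates down by `s, 2 s, …, (2 ^ (d + 4) - 1) s`. -/
noncomputable def shiftDown (d s A : ℕ) : ℕ :=
  Nat.rec (motive := fun _ => ℕ → ℕ → ℕ)
    (fun s A => (fun s A => (fun s A => (fun s A => Nat.lor A (Nat.shiftRight A s))
          (Nat.mul 2 s) (Nat.lor A (Nat.shiftRight A s)))
        (Nat.mul 2 s) (Nat.lor A (Nat.shiftRight A s)))
      (Nat.mul 2 s) (Nat.lor A (Nat.shiftRight A s)))
    (fun _ ih s A => ih (Nat.mul 2 s) (Nat.lor A (Nat.shiftRight A s))) d s A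

/-- Every block of `W` bits of `A`, together with its translates up by multiples of `s`;
`R` has the lowest bit of each block and `R' = R <<< W`. -/
noncomputable def shiftUp (R R' W s A : ℕ) : ℕ :=
  Nat.rec (motive := fun _ => ℕ → ℕ → ℕ) (fun _ A => A)
    (fun _ ih s A => Bool.rec A
      (ih (Nat.mul 2 s)
        (Nat.lor A (Nat.land (Nat.shiftLeft A s) (Nat.sub R' (Nat.shiftLeft R s)))))
      (Nat.ble s W)) 8 s A

/-- The lowest set bit of `f` and all bits below it. -/
noncomputable def lowMask (f : ℕ) : ℕ := Nat.xor f (Nat.sub f 1)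

/-- Lane `i` holds the number of elements of `T` below `N - i`. -/
noncomputable def prefixLanes (o bL T : ℕ) : ℕ := Nat.shiftRight (Nat.mul T o) bL

/-- The constant from which the lanes of `e * t` are subtracted to compare them with `x`. -/
noncomputable def offset (b N o : ℕ) : ℕ :=
  Nat.add (Nat.pow 2 (Nat.mul b N)) (Nat.add (Nat.sub (Nat.shiftLeft o (Nat.sub b 1)) o)
    (Nat.shiftRight (Nat.mul o o) (Nat.mul b (Nat.succ N))))

/-- The lanes `x` in which `x ≤ k * t x` fails. -/
noncomputable def failLanes (H X k P : ℕ) : ℕ := Nat.land H (Nat.sub X (Nat.mul k P))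

/-- Whether `x ≤ k * t x` holds for all `x` from `N - m` to `N`, and for all `x ≤ N` above the
largest integer missing from `T`. -/
noncomputable def leafTest (o H X M k T P : ℕ) : Bool :=
  Nat.beq 0 (Nat.land (failLanes H X k P) (Nat.lor (lowMask (Nat.xor o T)) M))

/-- The `n` lowest lanes, filled. -/
noncomputable def lowLanes (b n : ℕ) : ℕ := Nat.sub (Nat.pow 2 (Nat.mul b n)) 1

/-- The submonoid generated by `A`, with `x` stored in lane `N - x`. -/
noncomputable def genLanes (b d N : ℕ) (A : List ℕ) : ℕ :=
  List.rec (Nat.pow 2 (Nat.mul b N)) (fun g _ ih => shiftDown d (Nat.mul b g) ih) A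

/-- The leaf test for the semigroup generated by `A`, from scratch. -/
noncomputable def bigLeaf (b d N m k : ℕ) (A : List ℕ) : Bool :=
  (fun o => (fun T => leafTest o (Nat.shiftLeft o (Nat.sub b 1)) (offset b N o)
      (lowLanes b (Nat.succ m)) k T (prefixLanes o (Nat.mul b (Nat.succ N)) T))
    (genLanes b d N A)) (ones b (Nat.succ N))

/-- The leaf test with wide lanes, for generators whose greatest common divisor is `1`. -/
noncomputable def slowLeaf (m k : ℕ) (A : List ℕ) : Bool :=
  Bool.rec true (bigLeaf 19 8 (Nat.mul m (Nat.div 3600 m)) m k A)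
    (Nat.beq 1 (List.rec 0 (fun g _ ih => Nat.gcd g ih) A))

/-- All choices of the next primitive in `[q, q + n)` after `A`: each is tested as the last
primitive by `leaf` and as a further one by `ih`, unless the masks `K₁`, `K₂`, `KT` decide the
question. The lowest block of `Z` covers the submonoid generated by `A` and the integers from `q`
to `60`. -/
noncomputable def scan (W : ℕ) (mem : ℕ → ℕ → Bool) (aT : ℕ → ℕ → ℕ)
    (leaf : ℕ → List ℕ → ℕ → Bool) (ih : List ℕ → ℕ → ℕ → ℕ → ℕ → Bool) (A : List ℕ)
    (k T K₁ K₂ KT : ℕ) : ℕ → ℕ → ℕ → Bool :=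
  fun n => Nat.rec (motive := fun _ => ℕ → ℕ → Bool) (fun _ _ => true)
    (fun _ next q Z => Bool.rec true
      (Bool.rec false (next (Nat.succ q) (Nat.shiftRight Z W))
        (Bool.rec
          ((fun T' => Bool.rec false
              (Bool.rec true (ih (q :: A) (Nat.succ k) T' Z q) (Nat.beq (Nat.land Z K₂) K₂))
              (Bool.rec true (leaf (Nat.succ k) (q :: A) T') (Nat.beq (Nat.land T' KT) KT)))
            (aT q T))
          true (mem q T)))
      (Nat.beq (Nat.land Z K₁) K₁)) n

/-- `scan` with the masks that the semigroup `T` generated by `A` determines. -/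
noncomputable def node (W : ℕ) (pref : ℕ → ℕ) (failMask : ℕ → ℕ → ℕ → ℕ)
    (topMask laneMask : ℕ → ℕ) (mem : ℕ → ℕ → Bool) (aT : ℕ → ℕ → ℕ) (leaf : ℕ → List ℕ → ℕ → Bool)
    (ih : List ℕ → ℕ → ℕ → ℕ → ℕ → Bool) (A : List ℕ) (k T n q Z : ℕ) : Bool :=
  (fun P => (fun M₁ =>
      scan W mem aT leaf ih A k T (topMask M₁) (topMask (failMask k 2 P)) (laneMask M₁) n q Z)
    (failMask k 1 P)) (pref T)

/-- The search with bounded depth, every node of which is treated by `nd`. -/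
noncomputable def search (W : ℕ) (aU : ℕ → ℕ → ℕ)
    (nd : (List ℕ → ℕ → ℕ → ℕ → ℕ → Bool) → List ℕ → ℕ → ℕ → ℕ → ℕ → ℕ → Bool) :
    ℕ → List ℕ → ℕ → ℕ → ℕ → ℕ → Bool :=
  fun fuel => Nat.rec (motive := fun _ => List ℕ → ℕ → ℕ → ℕ → ℕ → Bool) (fun _ _ _ _ _ => false)
    (fun _ ih A k T V q => nd ih A k T (Nat.sub 60 q) (Nat.succ q) (Nat.shiftRight (aU q V) W)) fuel

/-- Blocks covering the submonoids generated by `m` and the integers from `q` to `60`, for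
`q = 61 - n, …, 60`. -/
noncomputable def rootBlocks (W m n : ℕ) : ℕ :=
  Nat.rec (motive := fun _ => ℕ → ℕ → ℕ → ℕ) (fun _ _ U => U)
    (fun _ ih q V U => (fun V' => ih (Nat.sub q 1) V' (Nat.lor V' (Nat.shiftLeft U W)))
      (shiftUp 1 (Nat.pow 2 W) W q V))
    n 60 (shiftUp 1 (Nat.pow 2 W) W m 1) 0

/-- `check` with lanes of `b` bits for the integers up to `N` and blocks of `W` bits. -/
noncomputable def checkWith (b d N W m lo n : ℕ) : Bool :=
  (fun L => (fun bL o => (fun H X M => (fun I B₁ B₂ R => (fun R' W2 =>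
    (fun nd =>
      nd (search W (fun q V => shiftUp R R' W q V) nd 60) [m] 1
      (shiftDown d (Nat.mul b m) (Nat.pow 2 (Nat.mul b N))) n lo (rootBlocks W m (Nat.sub 61 lo)))
    (fun ih A k T n q Z => node W (fun T => prefixLanes o bL T)
      (fun k r P => lowMask (failLanes H X (Nat.add k r) (Nat.add P (Nat.mul r I))))
      (fun F => Nat.sub W2 (Nat.shiftLeft 1 (Nat.sub L (Nat.div (Nat.mod F B₂) B₁))))
      (fun F => Nat.land o (Nat.sub F M))
      (fun q T => Nat.beq 1 (Nat.land 1 (Nat.shiftRight T (Nat.mul b (Nat.sub N q)))))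
      (fun q T => shiftDown d (Nat.mul b q) T)
      (fun k A T => Bool.rec (slowLeaf m k A) true (leafTest o H X M k T (prefixLanes o bL T)))
      ih A k T n q Z))
     (Nat.shiftLeft R W) (Nat.pow 2 W))
    (Nat.shiftLeft (ones b (Nat.sub N (Nat.add m 61))) (Nat.mul b (Nat.succ m)))
    (Nat.sub (Nat.pow 2 b) 1) (Nat.pow (Nat.sub (Nat.pow 2 b) 1) 2) (ones W 61))
    (Nat.shiftLeft o (Nat.sub b 1)) (offset b N o) (lowLanes b (Nat.succ m)))
    (Nat.mul b L) (ones b L)) (Nat.succ N)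

/-- The search over all numerical semigroups with smallest primitive `m`, second smallest
primitive in `[lo, lo + n)` and all primitives at most `60`. -/
noncomputable def check (m lo n : ℕ) : Bool :=
  checkWith 16 (Nat.sub (Nat.succ (Nat.log2 (Nat.add (Nat.div 192 m) 2))) 4)
    (Nat.mul m (Nat.add (Nat.div 192 m) 2)) 192 m lo n

/-! ### Digit vectors packed into one number -/

/-- The number with digit `f i` at position `i < L` in base `2 ^ b`. -/
def pack (b L : ℕ) (f : ℕ → ℕ) : ℕ := ∑ i ∈ Finset.range L, f i * 2 ^ (b * i)

theorem pack_succ (b L : ℕ) (f : ℕ → ℕ) :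
    pack b (L + 1) f = pack b L f + f L * 2 ^ (b * L) :=
  Finset.sum_range_succ _ _

theorem pack_succ' (b L : ℕ) (f : ℕ → ℕ) :
    pack b (L + 1) f = f 0 + 2 ^ b * pack b L (fun i => f (i + 1)) := by
  rw [pack, Finset.sum_range_succ', pack, Finset.mul_sum, add_comm]
  congr 1
  · simp
  · refine Finset.sum_congr rfl fun i _ => ?_
    rw [Nat.mul_add, pow_add]; ring

theorem pack_congr {b L : ℕ} {f g : ℕ → ℕ} (h : ∀ i < L, f i = g i) :
    pack b L f = pack b L g :=
  Finset.sum_congr rfl fun i hi => by rw [h i (Finset.mem_range.1 hi)]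

theorem pack_add (b L : ℕ) (f g : ℕ → ℕ) :
    pack b L f + pack b L g = pack b L (fun i => f i + g i) := by
  simp only [pack, ← Finset.sum_add_distrib, add_mul]

theorem pack_mul (b L k : ℕ) (f : ℕ → ℕ) : k * pack b L f = pack b L (fun i => k * f i) := by
  simp only [pack, Finset.mul_sum, mul_assoc]

/-- No digit borrows from the next one, so subtraction acts digit by digit. -/
theorem pack_sub {b L : ℕ} {f g : ℕ → ℕ} (h : ∀ i < L, g i ≤ f i) :
    pack b L f - pack b L g = pack b L (fun i => f i - g i) := by
  have : pack b L f = pack b L (fun i => f i - g i) + pack b L g := by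
    rw [pack_add]
    exact pack_congr fun i hi => (Nat.sub_add_cancel (h i hi)).symm
  omega

theorem pack_lt {b L : ℕ} {f : ℕ → ℕ} (h : ∀ i < L, f i < 2 ^ b) :
    pack b L f < 2 ^ (b * L) := by
  induction L with
  | zero => simp [pack]
  | succ L ih =>
    rw [pack_succ, Nat.mul_succ, pow_add]
    have h1 := ih fun i hi => h i (by omega)
    have h2 := Nat.mul_le_mul_right (2 ^ (b * L)) (Nat.succ_le_of_lt (h L (by omega)))
    rw [Nat.succ_mul] at h2
    rw [mul_comm (2 ^ (b * L))]
    omega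

theorem testBit_pack {b L : ℕ} {f : ℕ → ℕ} (h : ∀ i < L, f i < 2 ^ b) {r : ℕ} (hr : r < b)
    (i : ℕ) : (pack b L f).testBit (b * i + r) = (decide (i < L) && (f i).testBit r) := by
  induction L with
  | zero => simp [pack]
  | succ L ih =>
    have ih := ih fun i hi => h i (by omega)
    rw [pack_succ, add_comm, mul_comm (f L),
      Nat.testBit_two_pow_mul_add _ (pack_lt fun i hi => h i (by omega))]
    rcases lt_trichotomy i L with hi | rfl | hi
    · have : b * i + r < b * L := by
        have := Nat.mul_le_mul_left b (Nat.succ_le_of_lt hi)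
        rw [Nat.mul_succ] at this; omega
      rw [if_pos this, ih]
      simp [hi, Nat.lt_succ_of_lt hi]
    · simp
    · have h1 : b * L + b ≤ b * i := by
        have := Nat.mul_le_mul_left b (Nat.succ_le_of_lt hi)
        rwa [Nat.mul_succ] at this
      rw [if_neg (by omega)]
      have : (f L).testBit (b * i + r - b * L) = false :=
        Nat.testBit_lt_two_pow ((h L (by omega)).trans_le
          (Nat.pow_le_pow_right two_pos (by omega)))
      rw [this]
      simp [show ¬ i < L + 1 by omega]

theorem ones_eq_pack {b : ℕ} (hb : 0 < b) (L : ℕ) : ones b L = pack b L (fun _ => 1) := by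
  change (2 ^ (b * L) - 1) / (2 ^ b - 1) = _
  have h1 : 1 < 2 ^ b := Nat.one_lt_two_pow hb.ne'
  have key : 2 ^ (b * L) = (2 ^ b - 1) * pack b L (fun _ => 1) + 1 := by
    induction L with
    | zero => simp [pack]
    | succ L ih =>
      rw [pack_succ, Nat.mul_succ, pow_add, one_mul, Nat.mul_add, add_right_comm, ← ih,
        add_comm, ← Nat.succ_mul, mul_comm, Nat.succ_eq_add_one, Nat.sub_add_cancel h1.le]
  rw [key, Nat.add_sub_cancel, Nat.mul_div_cancel_left _ (by omega)]

/-- The digits of the upper half of `pack f * ones` are the suffix sums of `f`. -/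
theorem prefixLanes_pack {b N : ℕ} (hb : 0 < b) {f t : ℕ → ℕ}
    (ht : ∀ i < N, t i = t (i + 1) + f (i + 1)) (ht0 : t N = 0) (hbd : t 0 + f 0 < 2 ^ b) :
    prefixLanes (ones b (N + 1)) (b * (N + 1)) (pack b (N + 1) f) = pack b (N + 1) t := by
  change (pack b (N + 1) f * ones b (N + 1)) >>> (b * (N + 1)) = _
  rw [ones_eq_pack hb]
  -- `c i` is the sum f 0 + … + f i. These are the lower N + 1 digits of the product, which the
  -- shift discards.
  set c : ℕ → ℕ := fun i => t 0 + f 0 - t i with hc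
  set B := 2 ^ b with hB
  have hB1 : 1 < B := Nat.one_lt_two_pow hb.ne'
  have hle : ∀ i ≤ N, t i ≤ t 0 := by
    intro i hi
    induction i with
    | zero => exact le_rfl
    | succ i ih => have := ih (by omega); have := ht i (by omega); omega
  have e1 : pack b (N + 1) f + pack b (N + 1) t = (t 0 + f 0) + B * pack b (N + 1) t := by
    rw [pack_add, pack_succ', pack_succ b N t, ht0, zero_mul, add_zero, add_comm (f 0)]
    congr 2
    exact pack_congr fun i hi => by rw [ht i hi, add_comm]
  have e2 : pack b (N + 1) c = pack b (N + 1) f + B * pack b N c := by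
    rw [pack_succ', pack_succ', add_assoc, ← mul_add, pack_add]
    congr 1
    · simp [hc]
    · congr 1
      refine pack_congr fun i hi => ?_
      have := ht i hi
      have := hle i hi.le
      simp only [hc]; omega
  have e3 : pack b (N + 1) c = pack b N c + (t 0 + f 0) * B ^ N := by
    rw [pack_succ, hc, hB, ← pow_mul]; simp [ht0]
  have e4 : B * pack b (N + 1) (fun _ => 1) + 1 = B ^ (N + 1) + pack b (N + 1) (fun _ => 1) := by
    have h1 := pack_succ' b (N + 1) (fun _ => 1)
    have h2 := pack_succ b (N + 1) (fun _ => 1)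
    rw [pow_mul] at h2
    rw [hB]
    omega
  have key : pack b (N + 1) f * pack b (N + 1) (fun _ => 1)
      = B ^ (N + 1) * pack b (N + 1) t + pack b (N + 1) c := by
    -- Multiplying by B - 1 turns the factor with all digits 1 into B ^ (N + 1) - 1, and the
    -- identity becomes linear in `e1`, …, `e4`.
    have hB0 : ((B : ℤ) - 1) ≠ 0 := by
      have : (1 : ℤ) < B := by exact_mod_cast hB1
      omega
    zify at e1 e2 e3 e4 ⊢
    apply mul_left_cancel₀ hB0
    linear_combination (pack b (N + 1) f : ℤ) * e4 + (B : ℤ) ^ (N + 1) * e1 + e2 - B * e3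
  have hlt : pack b (N + 1) c < 2 ^ (b * (N + 1)) := pack_lt fun i _ => by
    simp only [hc]; omega
  rw [key, Nat.shiftRight_eq_div_pow, hB, ← pow_mul, Nat.mul_add_div (by positivity),
    Nat.div_eq_of_lt hlt, add_zero]

/-! ### Sets of integers as lanes, and adding a generator -/

open Classical in
/-- The elements of `T` up to `N`, with `x` stored in lane `N - x`. -/
noncomputable def laneSet (b N : ℕ) (T : Set ℕ) : ℕ :=
  pack b (N + 1) (fun i => if N - i ∈ T then 1 else 0)

theorem testBit_lt_of_one {v b r : ℕ} (hb : 0 < b) (hv : v ≤ 1) : v < 2 ^ b ∧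
    (v.testBit r = true ↔ v = 1 ∧ r = 0) := by
  refine ⟨hv.trans_lt (Nat.one_lt_two_pow hb.ne'), ?_⟩
  interval_cases v
  · simp
  · rw [Nat.testBit_one_eq_true_iff_self_eq_zero]; simp

theorem testBit_laneSet {b : ℕ} (hb : 0 < b) (N : ℕ) (T : Set ℕ) (p : ℕ) :
    (laneSet b N T).testBit p = true ↔ ∃ x ≤ N, x ∈ T ∧ p = b * (N - x) := by
  classical
  have h1 : ∀ i, (if N - i ∈ T then 1 else 0 : ℕ) ≤ 1 := fun i => by split_ifs <;> simp
  have := testBit_pack (L := N + 1) (f := fun i => if N - i ∈ T then 1 else 0)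
    (fun i _ => (testBit_lt_of_one (r := 0) hb (h1 i)).1) (Nat.mod_lt p hb) (p / b)
  rw [Nat.div_add_mod] at this
  rw [laneSet, this, Bool.and_eq_true, decide_eq_true_iff, (testBit_lt_of_one hb (h1 _)).2]
  constructor
  · rintro ⟨hi, hT, hr⟩
    refine ⟨N - p / b, Nat.sub_le _ _, by by_contra h; simp [h] at hT, ?_⟩
    rw [Nat.sub_sub_self (by omega)]
    have := Nat.div_add_mod p b
    omega
  · rintro ⟨x, hx, hxT, rfl⟩
    rw [Nat.mul_div_cancel_left _ hb, Nat.sub_sub_self hx]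
    exact ⟨by omega, by simp [hxT], by simp⟩

theorem laneSet_ext {b : ℕ} (hb : 0 < b) {N : ℕ} {T : Set ℕ} {A : ℕ}
    (h : ∀ p, A.testBit p = true ↔ ∃ x ≤ N, x ∈ T ∧ p = b * (N - x)) : A = laneSet b N T :=
  Nat.eq_of_testBit_eq fun p => by
    rw [Bool.eq_iff_iff, h, testBit_laneSet hb]

theorem laneSet_testBit_mul {b : ℕ} (hb : 0 < b) {N x : ℕ} (hx : x ≤ N) (T : Set ℕ) :
    (laneSet b N T).testBit (b * (N - x)) = true ↔ x ∈ T := by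
  rw [testBit_laneSet hb]
  constructor
  · rintro ⟨y, hy, hyT, h⟩
    have := Nat.eq_of_mul_eq_mul_left hb h
    rwa [show x = y by omega]
  · exact fun h => ⟨x, hx, h, rfl⟩

/-- Binary doubling: every i < 2 n is 2 i' or 2 i' + 1 with i' < n, so one extra shift doubles the
number of translates. -/
theorem shiftDown_step {n : ℕ} {f : ℕ → ℕ → ℕ}
    (hf : ∀ s A p, (f s A).testBit p = true ↔ ∃ i < n, A.testBit (p + i * s) = true) (s A p : ℕ) :
    (f (Nat.mul 2 s) (Nat.lor A (Nat.shiftRight A s))).testBit p = true ↔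
      ∃ i < 2 * n, A.testBit (p + i * s) = true := by
  have e : ∀ q, (Nat.lor A (Nat.shiftRight A s)).testBit q = true ↔
      (A.testBit q = true ∨ A.testBit (q + s) = true) := fun q => by
    change (A ||| A >>> s).testBit q = true ↔ _
    rw [Nat.testBit_or, Nat.testBit_shiftRight, Bool.or_eq_true, add_comm s]
  rw [hf]
  simp only [e]
  constructor
  · rintro ⟨i, hi, h | h⟩
    · exact ⟨2 * i, by omega, by rwa [mul_comm 2 i, mul_assoc]⟩
    · refine ⟨2 * i + 1, by omega, ?_⟩
      have : p + (2 * i + 1) * s = p + i * Nat.mul 2 s + s := by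
        change _ = p + i * (2 * s) + s; ring
      rwa [this]
  · rintro ⟨i, hi, h⟩
    refine ⟨i / 2, by omega, ?_⟩
    obtain ⟨k, rfl | rfl⟩ := Nat.even_or_odd' i
    · left
      rw [Nat.mul_div_cancel_left _ two_pos]
      change A.testBit (p + k * (2 * s)) = true
      rwa [show p + k * (2 * s) = p + 2 * k * s by ring]
    · right
      rw [show (2 * k + 1) / 2 = k by omega]
      change A.testBit (p + k * (2 * s) + s) = true
      rwa [show p + k * (2 * s) + s = p + (2 * k + 1) * s by ring]

theorem testBit_shiftDown (d s A p : ℕ) : (shiftDown d s A).testBit p = true ↔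
    ∃ i < 2 ^ (d + 4), A.testBit (p + i * s) = true := by
  induction d generalizing s A p with
  | zero =>
    have h0 : ∀ s A p : ℕ, ((fun _ A => A : ℕ → ℕ → ℕ) s A).testBit p = true ↔
        ∃ i < 1, A.testBit (p + i * s) = true := by
      intro s A p; simp
    have h1 := shiftDown_step h0
    have h2 := shiftDown_step (f := fun s A => Nat.lor A (Nat.shiftRight A s)) h1
    have h3 := shiftDown_step (f := fun s A => (fun s A => Nat.lor A (Nat.shiftRight A s))
          (Nat.mul 2 s) (Nat.lor A (Nat.shiftRight A s))) h2
    exact shiftDown_step (f := fun s A => (fun s A => (fun s A => Nat.lor A (Nat.shiftRight A s))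
          (Nat.mul 2 s) (Nat.lor A (Nat.shiftRight A s)))
        (Nat.mul 2 s) (Nat.lor A (Nat.shiftRight A s))) h3 s A p
  | succ d ih =>
    have := shiftDown_step (f := shiftDown d) ih s A p
    rw [show 2 ^ (d + 1 + 4) = 2 * 2 ^ (d + 4) by ring]
    exact this

theorem mem_closure_insert {g : ℕ} {A : Set ℕ} {y : ℕ} :
    y ∈ AddSubmonoid.closure (insert g A) ↔ ∃ i, ∃ t ∈ AddSubmonoid.closure A, y = t + i * g := by
  rw [Set.insert_eq, AddSubmonoid.closure_union, AddSubmonoid.mem_sup]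
  simp only [AddSubmonoid.mem_closure_singleton]
  constructor
  · rintro ⟨_, ⟨n, rfl⟩, t, ht, rfl⟩
    exact ⟨n, t, ht, by simp [add_comm]⟩
  · rintro ⟨i, t, ht, rfl⟩
    exact ⟨_, ⟨i, rfl⟩, t, ht, by simp [add_comm]⟩

/-- As x sits in lane N - x, adding g is a shift to the right, and sums beyond N drop off the end.
Multiples i * g with i ≥ 2 ^ (d + 4) exceed N and are not needed. -/
theorem shiftDown_laneSet {b d N g : ℕ} (hb : 0 < b) (hg : N < 2 ^ (d + 4) * g) (A : Set ℕ) :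
    shiftDown d (Nat.mul b g) (laneSet b N (AddSubmonoid.closure A)) =
      laneSet b N (AddSubmonoid.closure (insert g A)) := by
  refine laneSet_ext hb fun p => ?_
  rw [testBit_shiftDown]
  simp only [testBit_laneSet hb, SetLike.mem_coe, mem_closure_insert]
  constructor
  · rintro ⟨i, _, x, hx, hxA, h⟩
    have h' : p + b * (i * g) = b * (N - x) := by
      rw [← h]; change _ = p + i * (b * g); ring
    have hle : i * g ≤ N - x := Nat.le_of_mul_le_mul_left (by omega) hb
    refine ⟨x + i * g, by omega, ⟨i, x, hxA, rfl⟩, ?_⟩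
    rw [Nat.sub_add_eq, Nat.mul_sub b (N - x)]
    omega
  · rintro ⟨y, hy, ⟨i, t, ht, rfl⟩, rfl⟩
    have hg0 : 0 < g := Nat.pos_of_ne_zero fun h => by simp [h] at hg
    refine ⟨i, ?_, t, by omega, ht, ?_⟩
    · by_contra hi
      have := Nat.mul_le_mul_right g (not_lt.1 hi)
      omega
    · change b * (N - (t + i * g)) + i * (b * g) = _
      rw [show i * (b * g) = b * (i * g) by ring, ← Nat.mul_add]
      congr 1
      omega

/-! ### Masks -/

theorem exists_lowMask {f : ℕ} (hf : f ≠ 0) :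
    ∃ p, f.testBit p = true ∧ (∀ r < p, f.testBit r = false) ∧ lowMask f = 2 ^ (p + 1) - 1 := by
  obtain ⟨p, n, hn, rfl⟩ := Nat.exists_eq_two_pow_mul_odd hf
  obtain ⟨a, rfl⟩ := hn
  have hpos : 0 < 2 ^ p := by positivity
  have e1 : 2 ^ p * (2 * a + 1) = 2 ^ (p + 1) * a + 2 ^ p := by ring
  have e2 : 2 ^ p * (2 * a + 1) - 1 = 2 ^ (p + 1) * a + (2 ^ p - 1) := by omega
  have l1 : 2 ^ p < 2 ^ (p + 1) := Nat.pow_lt_pow_right one_lt_two (by omega)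
  refine ⟨p, ?_, fun r hr => ?_, ?_⟩
  · rw [Nat.testBit_two_pow_mul]; simp
  · rw [Nat.testBit_two_pow_mul]; simp [hr]
  · change (2 ^ p * (2 * a + 1)) ^^^ (2 ^ p * (2 * a + 1) - 1) = _
    rw [e2, e1]
    refine Nat.eq_of_testBit_eq fun r => ?_
    rw [Nat.testBit_xor, Nat.testBit_two_pow_mul_add _ l1,
      Nat.testBit_two_pow_mul_add _ (by omega : 2 ^ p - 1 < 2 ^ (p + 1)),
      Nat.testBit_two_pow_sub_one, Nat.testBit_two_pow_sub_one]
    by_cases h : r < p + 1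
    · rw [if_pos h, if_pos h, Nat.testBit_two_pow]
      rcases Nat.lt_succ_iff_lt_or_eq.1 h with h' | rfl
      · simp [h', h, h'.ne']
      · simp
    · simp [h]

theorem testBit_lowLanes (b n p : ℕ) : (lowLanes b n).testBit p = decide (p < b * n) :=
  Nat.testBit_two_pow_sub_one _ _

/-- With a = 2 ^ b - 1, the binomial expansion gives (a + 1) ^ n - 1 ≡ n a modulo a ^ 2. This
recovers the number of filled lanes of a mask by two arithmetic operations. -/
theorem mask_mod_div {b n : ℕ} (hn : n < 2 ^ b - 1) :
    (2 ^ (b * n) - 1) % (2 ^ b - 1) ^ 2 / (2 ^ b - 1) = n := by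
  obtain ⟨a, ha⟩ : ∃ a, 2 ^ b = a + 1 := ⟨2 ^ b - 1, (Nat.sub_add_cancel (Nat.one_le_two_pow)).symm⟩
  replace hn : n < a := by omega
  rw [pow_mul, ha, Nat.add_sub_cancel]
  obtain ⟨c, hc⟩ : ∃ c, (a + 1) ^ n = a ^ 2 * c + n * a + 1 := by
    clear hn
    induction n with
    | zero => exact ⟨0, by simp⟩
    | succ n ih =>
      obtain ⟨c, hc⟩ := ih
      exact ⟨c * a + c + n, by rw [pow_succ, hc]; ring⟩
  rw [hc, Nat.add_sub_cancel, Nat.mul_add_mod, Nat.mod_eq_of_lt, Nat.mul_div_cancel _ (by omega)]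
  rw [pow_two]
  exact Nat.mul_lt_mul_of_pos_right hn (by omega : 0 < a)

theorem exists_of_land_ne {Z K : ℕ} (h : Nat.beq (Nat.land Z K) K = false) :
    ∃ p, K.testBit p = true ∧ Z.testBit p = false := by
  by_contra hcon
  push Not at hcon
  have : Z &&& K = K := Nat.eq_of_testBit_eq fun p => by
    rw [Nat.testBit_and]
    cases hK : K.testBit p
    · simp
    · simpa using hcon p hK
  rw [show Nat.land Z K = Z &&& K from rfl, this] at h
  simp [Nat.beq_refl] at h

theorem testBit_sub_shiftLeft {W x y : ℕ}
    (h : (Nat.sub (2 ^ W) (Nat.shiftLeft 1 x)).testBit y = true) : x ≤ y ∧ y < W := by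
  change (2 ^ W - (1 <<< x)).testBit y = true at h
  rw [Nat.one_shiftLeft] at h
  by_cases hx : W ≤ x
  · rw [Nat.sub_eq_zero_of_le (Nat.pow_le_pow_right two_pos hx)] at h
    simp at h
  · have e : 2 ^ W - 2 ^ x = 2 ^ x * (2 ^ (W - x) - 1) := by
      rw [Nat.mul_sub, ← pow_add, Nat.add_sub_cancel' (by omega), mul_one]
    rw [e, Nat.testBit_two_pow_mul, Nat.testBit_two_pow_sub_one] at h
    simp at h
    omega

/-! ### Counting functions in lanes and their comparison with x -/

open Classical in
/-- The number of elements of `T` below `x`. -/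
noncomputable def cnt (T : Set ℕ) (x : ℕ) : ℕ := Nat.count (· ∈ T) x

theorem cnt_zero (T : Set ℕ) : cnt T 0 = 0 := by classical exact Nat.count_zero _

open Classical in
theorem cnt_succ (T : Set ℕ) (x : ℕ) : cnt T (x + 1) = cnt T x + if x ∈ T then 1 else 0 :=
  Nat.count_succ _ _

theorem cnt_le (T : Set ℕ) (x : ℕ) : cnt T x ≤ x := by classical exact Nat.count_le _

theorem prefixLanes_laneSet {b N : ℕ} (hb : 0 < b) (hN : N + 1 < 2 ^ b) (T : Set ℕ) :
    prefixLanes (ones b (N + 1)) (b * (N + 1)) (laneSet b N T) =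
      pack b (N + 1) (fun i => cnt T (N - i)) := by
  classical
  refine prefixLanes_pack hb (fun i hi => ?_) (by simp [cnt_zero]) ?_
  · rw [show N - i = N - (i + 1) + 1 by omega, cnt_succ]
  · have := cnt_le T N
    simp only [Nat.sub_zero]
    split_ifs <;> omega

theorem prefixLanes_ones {b N : ℕ} (hb : 0 < b) (hN : N + 1 < 2 ^ b) :
    prefixLanes (ones b (N + 1)) (b * (N + 1)) (ones b (N + 1)) =
      pack b (N + 1) (fun i => N - i) := by
  have h := prefixLanes_pack (N := N) (t := fun i => N - i) (f := fun _ => 1) hb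
    (fun i hi => by omega) (by simp) (by simpa using hN)
  rwa [← ones_eq_pack hb] at h

theorem ones_shiftLeft {b : ℕ} (hb : 0 < b) (L : ℕ) :
    Nat.shiftLeft (ones b L) (Nat.sub b 1) = pack b L (fun _ => 2 ^ (b - 1)) := by
  change (ones b L) <<< (b - 1) = _
  rw [Nat.shiftLeft_eq, ones_eq_pack hb, mul_comm, pack_mul]
  simp

theorem offset_eq {b N : ℕ} (hb : 0 < b) (hN : N + 1 < 2 ^ b) :
    offset b N (ones b (N + 1)) =
      pack b (N + 1) (fun i => 2 ^ (b - 1) - 1 + max 1 (N - i)) := by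
  have e : offset b N (ones b (N + 1)) = 2 ^ (b * N) +
      ((Nat.shiftLeft (ones b (N + 1)) (Nat.sub b 1) - ones b (N + 1)) +
        prefixLanes (ones b (N + 1)) (b * (N + 1)) (ones b (N + 1))) := rfl
  -- This summand raises the lane of x = 0 from 0 to 1, so that this lane always fails and the set
  -- of failing lanes is never empty.
  have h1 : (2 ^ (b * N) : ℕ) = pack b (N + 1) (fun i => if i = N then 1 else 0) := by
    rw [pack_succ, pack_congr (g := fun _ => 0) (fun i hi => if_neg hi.ne)]
    simp [pack]
  rw [e, prefixLanes_ones hb hN, ones_shiftLeft hb, ones_eq_pack hb,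
    pack_sub (fun _ _ => Nat.one_le_two_pow), h1, pack_add, pack_add]
  refine pack_congr fun i hi => ?_
  split_ifs with h
  · subst h; simp; omega
  · rw [max_eq_right (by omega)]; omega

/-- The lane of x holds 2 ^ (b - 1) - 1 + max 1 x - k t, which has its top bit set exactly when k t
< max 1 x. The bound on k t excludes borrows, so one subtraction compares all lanes. -/
theorem testBit_failLanes {b N k : ℕ} (hb : 0 < b) (hN : N < 2 ^ (b - 1)) {p : ℕ → ℕ}
    (hp : ∀ i ≤ N, k * p i < 2 ^ (b - 1)) (q : ℕ) :
    (failLanes (Nat.shiftLeft (ones b (N + 1)) (Nat.sub b 1)) (offset b N (ones b (N + 1))) k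
      (pack b (N + 1) p)).testBit q = true ↔
      ∃ i ≤ N, q = b * i + (b - 1) ∧ k * p i < max 1 (N - i) := by
  have h2 : 2 ^ b = 2 * 2 ^ (b - 1) := by
    rw [← pow_succ', Nat.sub_add_cancel hb]
  have h1 : 0 < 2 ^ (b - 1) := by positivity
  change ((Nat.shiftLeft (ones b (N + 1)) (Nat.sub b 1)) &&&
    (offset b N (ones b (N + 1)) - k * (pack b (N + 1) p))).testBit q = true ↔ _
  rw [ones_shiftLeft hb, offset_eq hb (by omega), pack_mul,
    pack_sub (fun i hi => by have := hp i (by omega); omega), Nat.testBit_and]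
  have t1 := testBit_pack (b := b) (L := N + 1) (f := fun _ => 2 ^ (b - 1))
    (fun i _ => by omega) (Nat.mod_lt q hb) (q / b)
  have hv : ∀ i < N + 1, 2 ^ (b - 1) - 1 + max 1 (N - i) - k * p i < 2 ^ b := fun i hi => by omega
  have t2 := testBit_pack (b := b) (L := N + 1)
    (f := fun i => 2 ^ (b - 1) - 1 + max 1 (N - i) - k * p i) hv (Nat.mod_lt q hb) (q / b)
  rw [Nat.div_add_mod] at t1 t2
  rw [t1, t2]
  have top : ∀ v < 2 ^ b, (v.testBit (b - 1) = true ↔ 2 ^ (b - 1) ≤ v) := by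
    intro v hv
    refine ⟨Nat.ge_two_pow_of_testBit, fun h => ?_⟩
    rw [show v = 2 ^ (b - 1) * 1 + (v - 2 ^ (b - 1)) by omega,
      Nat.testBit_two_pow_mul_add _ (by omega)]
    simp
  simp only [Bool.and_eq_true, decide_eq_true_iff, Nat.testBit_two_pow]
  constructor
  · rintro ⟨⟨hi, hr⟩, -, h⟩
    rw [← hr, top _ (hv _ hi)] at h
    have := Nat.div_add_mod q b
    refine ⟨q / b, by omega, by omega, ?_⟩
    have := hp (q / b) (by omega)
    omega
  · rintro ⟨i, hi, rfl, h⟩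
    have e1 : (b * i + (b - 1)) / b = i := by
      rw [Nat.mul_add_div hb, Nat.div_eq_of_lt (by omega), add_zero]
    have e2 : (b * i + (b - 1)) % b = b - 1 := by
      rw [Nat.mul_add_mod, Nat.mod_eq_of_lt (by omega)]
    rw [e1, e2, top _ (hv _ (by omega))]
    have := hp i hi
    exact ⟨⟨by omega, rfl⟩, by omega, by omega⟩

/-! ### Blocks -/

/-- Block `j < n` of `W` bits of `Z` contains (at least) the elements of `U j` below `W`. -/
def Covers (W n Z : ℕ) (U : ℕ → Set ℕ) : Prop :=
  ∀ j < n, ∀ y < W, y ∈ U j → Z.testBit (W * j + y) = true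

/-- In each block the mask is 2 ^ W - 2 ^ s, with bits s, …, W - 1. It removes what a shift by s
spills over from the block below and loses no legitimate element. -/
theorem testBit_upMask {W Q s : ℕ} (hW : 0 < W) (hs : s ≤ W) {j y : ℕ} (hj : j < Q) (hy : y < W)
    (hsy : s ≤ y) :
    (Nat.sub (Nat.shiftLeft (ones W Q) W) (Nat.shiftLeft (ones W Q) s)).testBit (W * j + y)
      = true := by
  change (((ones W Q) <<< W) - ((ones W Q) <<< s)).testBit _ = true
  have hle : 2 ^ s ≤ 2 ^ W := Nat.pow_le_pow_right two_pos hs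
  have hpos : 0 < 2 ^ s := by positivity
  rw [Nat.shiftLeft_eq, Nat.shiftLeft_eq, ones_eq_pack hW, mul_comm, mul_comm _ (2 ^ s),
    pack_mul, pack_mul, pack_sub (fun _ _ => by simpa using hle),
    testBit_pack (fun _ _ => by omega) hy]
  have e : 2 ^ W * 1 - 2 ^ s * 1 = 2 ^ s * (2 ^ (W - s) - 1) := by
    rw [Nat.mul_sub, ← pow_add, Nat.add_sub_cancel' hs, mul_one]
  rw [e, Nat.testBit_two_pow_mul, Nat.testBit_two_pow_sub_one]
  simp
  omega

theorem Covers.shiftUp {W Q n : ℕ} (hW : 0 < W) (hn : n ≤ Q) {s A : ℕ} (hs : 0 < s)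
    (hW8 : W < 2 ^ 8 * s) {U : ℕ → Set ℕ} (h : Covers W n A U) :
    Covers W n (WilfSearch.shiftUp (ones W Q) (Nat.shiftLeft (ones W Q) W) W s A)
      (fun j => {y | ∃ i, ∃ t ∈ U j, y = t + i * s}) := by
  -- Each round doubles s and uses one unit of fuel, so W < 2 ^ f * s is invariant. At the end s
  -- exceeds W, and only the multiple 0 still fits into a block.
  have key : ∀ (f s A : ℕ) (U : ℕ → Set ℕ), 0 < s → W < 2 ^ f * s → Covers W n A U →
      Covers W n (Nat.rec (motive := fun _ => ℕ → ℕ → ℕ) (fun _ A => A)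
        (fun _ ih s A => Bool.rec A
          (ih (Nat.mul 2 s)
            (Nat.lor A (Nat.land (Nat.shiftLeft A s)
              (Nat.sub (Nat.shiftLeft (ones W Q) W) (Nat.shiftLeft (ones W Q) s)))))
          (Nat.ble s W)) f s A) (fun j => {y | ∃ i, ∃ t ∈ U j, y = t + i * s}) := by
    intro f
    induction f with
    | zero =>
      rintro s A U hs hW' h j hj y hy ⟨i, t, ht, rfl⟩
      obtain rfl : i = 0 := by
        by_contra hi
        have := Nat.mul_le_mul_right s (Nat.one_le_iff_ne_zero.2 hi)
        omega
      rw [zero_mul, add_zero] at *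
      exact h j hj t hy ht
    | succ f ih =>
      intro s A U hs hW' h
      cases hb : Nat.ble s W
      · rintro j hj y hy ⟨i, t, ht, rfl⟩
        simp only [hb]
        have hlt : W < s := by
          by_contra hcon
          rw [Nat.ble_eq_true_of_le (not_lt.1 hcon)] at hb
          simp at hb
        obtain rfl : i = 0 := by
          by_contra hi
          have := Nat.mul_le_mul_right s (Nat.one_le_iff_ne_zero.2 hi)
          omega
        rw [zero_mul, add_zero] at *
        exact h j hj t hy ht
      · have hle := Nat.le_of_ble_eq_true hb
        have h' : Covers W n (Nat.lor A (Nat.land (Nat.shiftLeft A s)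
              (Nat.sub (Nat.shiftLeft (ones W Q) W) (Nat.shiftLeft (ones W Q) s))))
            (fun j => {y | y ∈ U j ∨ ∃ t ∈ U j, y = t + s}) := by
          rintro j hj y hy hyU
          change (A ||| ((A <<< s) &&& _)).testBit _ = true
          rw [Nat.testBit_or, Bool.or_eq_true]
          rcases hyU with hyU | ⟨t, ht, rfl⟩
          · exact Or.inl (h j hj y hy hyU)
          · right
            rw [Nat.testBit_and, testBit_upMask hW hle (hj.trans_le hn) hy (by omega),
              Nat.testBit_shiftLeft, ← add_assoc, Nat.add_sub_cancel,
              h j hj t (by omega) ht]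
            simp
        have := ih (Nat.mul 2 s) _ _ (Nat.mul_pos two_pos hs)
          (by change W < 2 ^ f * (2 * s); rw [pow_succ, mul_assoc] at hW'; exact hW') h'
        rintro j hj y hy ⟨i, t, ht, rfl⟩
        simp only [hb]
        refine this j hj _ hy ?_
        change ∃ i', ∃ t' ∈ {y | y ∈ U j ∨ ∃ t ∈ U j, y = t + s}, t + i * s = t' + i' * (2 * s)
        obtain ⟨k, rfl | rfl⟩ := Nat.even_or_odd' i
        · exact ⟨k, t, Or.inl ht, by ring⟩
        · exact ⟨k, t + s, Or.inr ⟨t, ht, rfl⟩, by ring⟩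
  exact key 8 s A U hs hW8 h

/-! ### Counting elements of numerical semigroups -/

theorem cnt_mono_set {T U : Set ℕ} (h : T ⊆ U) (x : ℕ) : cnt T x ≤ cnt U x := by
  classical exact Nat.count_mono_left fun _ _ hk => h hk

theorem cnt_add_card_le {T U : Set ℕ} (h : T ⊆ U) {x : ℕ} (Q : Finset ℕ)
    (hQ : ∀ q ∈ Q, q < x ∧ q ∈ U ∧ q ∉ T) : cnt T x + Q.card ≤ cnt U x := by
  classical
  simp only [cnt, Nat.count_eq_card_filter_range]
  rw [← Finset.card_union_of_disjoint]
  · refine Finset.card_le_card fun y hy => ?_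
    simp only [Finset.mem_union, Finset.mem_filter, Finset.mem_range] at hy ⊢
    rcases hy with hy | hy
    · exact ⟨hy.1, h hy.2⟩
    · exact ⟨(hQ y hy).1, (hQ y hy).2.1⟩
  · rw [Finset.disjoint_left]
    intro y hy hyQ
    exact (hQ y hyQ).2.2 (Finset.mem_filter.1 hy).2

/-- If the lower bound `x ≤ e * cnt T x` holds on one period below a multiple `N` of `m`, it
holds everywhere above. -/
theorem le_mul_cnt {T : Set ℕ} {m N j e : ℕ} (hm : 0 < m) (hT : ∀ x ∈ T, x + m ∈ T)
    (hN : N = j * m) (hj : 0 < j) (h : ∀ x, N - m ≤ x → x ≤ N → x ≤ e * cnt T x) :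
    ∀ x, N - m ≤ x → x ≤ e * cnt T x := by
  classical
  -- The increment of `cnt T` over a window of length m does not decrease when the window moves up,
  -- since x ∈ T implies x + m ∈ T.
  have step : ∀ x, cnt T (x + m) + cnt T (x + 1) ≤ cnt T (x + 1 + m) + cnt T x := by
    intro x
    rw [show x + 1 + m = x + m + 1 by ring, cnt_succ, cnt_succ]
    by_cases hx : x ∈ T
    · simp only [hx, hT x hx, if_true]; omega
    · rw [if_neg hx]; omega
  have win : ∀ x d, cnt T (x + m) + cnt T (x + d) ≤ cnt T (x + d + m) + cnt T x := by
    intro x d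
    induction d with
    | zero => simp [add_comm]
    | succ d ih => have := step (x + d); rw [← add_assoc]; omega
  have hNm : N - m + m = N := Nat.sub_add_cancel (hN ▸ Nat.le_mul_of_pos_left m hj)
  -- Each of the first i windows contains at most as many elements as the last one, [N - m, N).
  have hsum : ∀ i ≤ j, cnt T (i * m) + i * cnt T (N - m) ≤ i * cnt T N := by
    intro i hi
    induction i with
    | zero => simp [cnt_zero]
    | succ i ih =>
      have ih := ih (by omega)
      have hle : i * m ≤ N - m := by
        have := Nat.mul_le_mul_right m hi
        rw [Nat.succ_mul, ← hN] at this
        omega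
      have := win (i * m) (N - m - i * m)
      rw [Nat.add_sub_cancel' hle, hNm] at this
      rw [Nat.succ_mul, Nat.succ_mul, Nat.succ_mul]
      omega
  -- The last window contains at least the average `cnt T N` / j, and e * `cnt T N` ≥ N = j * m. So
  -- moving up by m raises e * `cnt T` by at least m.
  have hw : m + e * cnt T (N - m) ≤ e * cnt T N := by
    have h1 := hsum j le_rfl
    rw [← hN] at h1
    have h2 := Nat.mul_le_mul_left e h1
    have h3 := h N (Nat.sub_le _ _) le_rfl
    refine Nat.le_of_mul_le_mul_left ?_ hj
    calc j * (m + e * cnt T (N - m)) = j * m + e * (j * cnt T (N - m)) := by ring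
      _ ≤ e * cnt T N + e * (j * cnt T (N - m)) := by rw [← hN]; omega
      _ ≤ e * (j * cnt T N) := by rw [← mul_add]; exact h2
      _ = j * (e * cnt T N) := by ring
  intro x
  induction x using Nat.strong_induction_on with
  | _ x ih =>
    intro hx
    by_cases hxN : x ≤ N
    · exact h x hx hxN
    have h1 := ih (x - m) (by omega) (by omega)
    have h2 := win (N - m) (x - N)
    rw [hNm, show N - m + (x - N) = x - m by omega, show x - m + m = x by omega] at h2
    have h3 := Nat.mul_le_mul_left e h2
    rw [mul_add, mul_add] at h3
    omega

/-- `F` is the Frobenius number of `S`. -/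
def IsFrob (S : NumericalSemigroup) (F : ℕ) : Prop :=
  F ∉ S.toAddSubmonoid ∧ ∀ x, F < x → x ∈ S.toAddSubmonoid

theorem exists_isFrob {S : NumericalSemigroup} (h1 : 1 ∉ S.toAddSubmonoid) :
    ∃ F : ℕ, S.frobenius = F ∧ IsFrob S F := by
  have hg := S.isGreatest_frobenius
  have h0 : (1 : ℤ) ≤ S.frobenius := hg.2 fun s hs h => h1 (by
    have : s = 1 := by exact_mod_cast h
    rwa [this] at hs)
  refine ⟨S.frobenius.toNat, by omega, fun hF => ?_, fun x hx => ?_⟩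
  · exact hg.1 _ hF (by omega)
  · by_contra hxS
    have : (x : ℤ) ≤ S.frobenius := hg.2 fun s hs h => hxS (by
      have : s = x := by exact_mod_cast h
      rwa [this] at hs)
    omega

/-- Because F is a gap, counting below F + 1 gives the same number as counting below F, namely ℓ(S).
-/
theorem satisfiesWilf_of_cnt {S : NumericalSemigroup} {F : ℕ} (hF : S.frobenius = F)
    (hFS : IsFrob S F) (h : F + 1 ≤ S.embeddingDimension * cnt S.toAddSubmonoid (F + 1)) :
    S.SatisfiesWilf := by
  classical
  have e : S.numLeft = cnt S.toAddSubmonoid (F + 1) := by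
    rw [cnt_succ, if_neg (by exact hFS.1), add_zero, cnt, Nat.count_eq_card_filter_range,
      numLeft, ← Set.ncard_coe_finset]
    congr 1
    ext s
    simp [leftElements, hF, and_comm]
  rw [SatisfiesWilf, NumericalSemigroup.conductor, hF, e]
  exact_mod_cast h

/-- Beyond N the bound for the smaller submonoid T persists by `le_mul_cnt`; only Frobenius numbers
below N need the finer count in S. -/
theorem satisfiesWilf_of_dense {S : NumericalSemigroup} {T : AddSubmonoid ℕ}
    (hTS : T ≤ S.toAddSubmonoid) (h1 : 1 ∉ S.toAddSubmonoid) {m N j e : ℕ} (hm : 0 < m)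
    (hmT : m ∈ T) (hN : N = j * m) (hj : 0 < j) (he : e ≤ S.embeddingDimension)
    (hd : ∀ x, N - m ≤ x → x ≤ N → x ≤ e * cnt T x)
    (hc : ∀ F, IsFrob S F → F + 1 ≤ N → F + 1 ≤ e * cnt S.toAddSubmonoid (F + 1)) :
    S.SatisfiesWilf := by
  obtain ⟨F, hF, hFS⟩ := exists_isFrob h1
  refine satisfiesWilf_of_cnt hF hFS (le_trans ?_ (Nat.mul_le_mul_right _ he))
  by_cases hFN : F + 1 ≤ N
  · exact hc F hFS hFN
  · refine (le_mul_cnt hm (fun x hx => T.add_mem hx hmT) hN hj hd (F + 1) (by omega)).trans ?_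
    exact Nat.mul_le_mul_left _ (cnt_mono_set (fun x hx => hTS hx) _)

theorem primitives_finite (S : NumericalSemigroup) : S.primitives.Finite :=
  S.isLeast_primitives.1.1

theorem closure_primitives (S : NumericalSemigroup) :
    AddSubmonoid.closure S.primitives = S.toAddSubmonoid :=
  S.isLeast_primitives.1.2

theorem mem_of_mem_primitives {S : NumericalSemigroup} {p : ℕ} (hp : p ∈ S.primitives) :
    p ∈ S.toAddSubmonoid ∧ p ≠ 0 :=
  ⟨((S.mem_primitives_iff p).1 hp).1, ((S.mem_primitives_iff p).1 hp).2.1⟩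

/-- A primitive that lies in the submonoid generated by some primitives is one of them. -/
theorem mem_of_mem_closure {S : NumericalSemigroup} {A : Set ℕ} (hA : A ⊆ S.primitives) {p : ℕ}
    (hp : p ∈ S.primitives) (h : p ∈ AddSubmonoid.closure A) : p ∈ A := by
  have hle : AddSubmonoid.closure A ≤ S.toAddSubmonoid :=
    AddSubmonoid.closure_le.2 fun a ha => (mem_of_mem_primitives (hA ha)).1
  have hprim := ((S.mem_primitives_iff p).1 hp).2
  have key : ∀ y ∈ AddSubmonoid.closure A, y = p → y ∈ A := by
    intro y hy
    induction hy using AddSubmonoid.closure_induction with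
    | mem y hy => exact fun _ => hy
    | zero => exact fun h => absurd h.symm hprim.1
    | add a b ha hb iha ihb =>
      intro h
      rcases hprim.2 a (hle ha) b (hle hb) h with rfl | rfl
      · rw [zero_add] at h ⊢; exact ihb h
      · rw [add_zero] at h ⊢; exact iha h
  exact key p h rfl

/-- The elements of a list, as a set. -/
def gens (A : List ℕ) : Set ℕ := {a | a ∈ A}

theorem gens_cons (q : ℕ) (A : List ℕ) : gens (q :: A) = insert q (gens A) := by
  ext; simp [gens]

theorem ncard_gens {A : List ℕ} (h : A.Nodup) : (gens A).ncard = A.length := by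
  classical
  rw [← List.toFinset_card_of_nodup h, ← Set.ncard_coe_finset]
  congr 1
  ext; simp [gens]

theorem embeddingDimension_eq {S : NumericalSemigroup} {A : List ℕ} (h : A.Nodup)
    (hA : gens A ⊆ S.primitives) :
    S.embeddingDimension = A.length + (S.primitives \ gens A).ncard := by
  rw [embeddingDimension, ← ncard_gens h, add_comm,
    Set.ncard_sdiff_add_ncard_of_subset hA (primitives_finite S)]

theorem embeddingDimension_le {S : NumericalSemigroup} (h60 : ∀ p ∈ S.primitives, p ≤ 60) :
    S.embeddingDimension ≤ 60 := by
  have : S.primitives ⊆ (Finset.Icc 1 60 : Finset ℕ) := fun p hp => by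
    have := (mem_of_mem_primitives hp).2
    have := h60 p hp
    simp; omega
  have h := Set.ncard_le_ncard this (Finset.finite_toSet _)
  rw [Set.ncard_coe_finset] at h
  rw [embeddingDimension]
  simpa using h

/-- Wilf's inequality from a lower bound for the counting function of the semigroup generated by
some of the primitives, when there are at least `r` further ones. -/
theorem satisfiesWilf_of_bound {S : NumericalSemigroup} (h60 : ∀ p ∈ S.primitives, p ≤ 60)
    {A : List ℕ} (hnd : A.Nodup) (hA : gens A ⊆ S.primitives) {r m N j x₁ y : ℕ}
    (hr : r ≤ (S.primitives \ gens A).ncard) (hm : 0 < m) (hmA : m ∈ A) (hN : N = j * m)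
    (hj : 0 < j) (h1 : 1 ∉ S.toAddSubmonoid) (hx₁ : x₁ < N - m)
    (hb : ∀ x, x₁ < x → x ≤ N → x ≤ (A.length + r) *
      (cnt (AddSubmonoid.closure (gens A)) x + r * (if 60 < x ∧ x < N - m then 1 else 0)))
    (hy : x₁ ≤ y) (hyS : y ∉ S.toAddSubmonoid) : S.SatisfiesWilf := by
  have hle : AddSubmonoid.closure (gens A) ≤ S.toAddSubmonoid :=
    AddSubmonoid.closure_le.2 fun a ha => (mem_of_mem_primitives (hA ha)).1
  refine satisfiesWilf_of_dense hle h1 hm (AddSubmonoid.subset_closure hmA) hN hj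
    (e := A.length + r) (by rw [embeddingDimension_eq hnd hA]; omega)
    (fun x hx hxN => ?_) (fun F hF hFN => ?_)
  · have := hb x (by omega) hxN
    -- On the last period the bonus r is switched off, because the bound to be propagated concerns T
    -- alone.
    rwa [if_neg (by omega), mul_zero, add_zero] at this
  · have hFy : y ≤ F := by
      by_contra h
      exact hyS (hF.2 y (by omega))
    refine (hb (F + 1) (by omega) hFN).trans (Nat.mul_le_mul_left _ ?_)
    split_ifs with h
    · have hfin : (S.primitives \ gens A).Finite := (primitives_finite S).subset Set.sdiff_subset
      have := cnt_add_card_le (T := AddSubmonoid.closure (gens A)) (U := S.toAddSubmonoid)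
        (fun x hx => hle hx) (x := F + 1) hfin.toFinset (fun q hq => by
          rw [Set.Finite.mem_toFinset] at hq
          have := h60 q hq.1
          exact ⟨by omega, (mem_of_mem_primitives hq.1).1,
            fun hc => hq.2 (mem_of_mem_closure hA hq.1 hc)⟩)
      rw [← Set.ncard_eq_toFinset_card _ hfin] at this
      omega
    · rw [mul_zero, add_zero]
      exact cnt_mono_set (fun x hx => hle hx) _

/-! ### Correctness of the tests for a complete set of primitives -/

theorem boolRec_eq_true {a b c : Bool} : (Bool.rec a b c : Bool) = true ↔
    (c = false ∧ a = true) ∨ (c = true ∧ b = true) := by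
  cases c <;> simp

theorem ones_eq_laneSet {b : ℕ} (hb : 0 < b) (N : ℕ) :
    ones b (N + 1) = laneSet b N Set.univ := by
  rw [ones_eq_pack hb, laneSet]; simp

/-- The lanes have `b` bits and represent the integers up to `N = j * m`. -/
structure Lanes (b N m j : ℕ) : Prop where
  pos : 0 < b
  lt : 63 * (N + 3) < 2 ^ (b - 1)
  eq : N = j * m
  jpos : 0 < j
  mpos : 0 < m

theorem Lanes.lt_two_pow {b N m j : ℕ} (h : Lanes b N m j) : 63 * (N + 3) < 2 ^ b :=
  h.lt.trans_le (Nat.pow_le_pow_right two_pos (by omega))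

theorem Lanes.mul_lt {b N m j : ℕ} (h : Lanes b N m j) {k t : ℕ} (hk : k ≤ 63) (ht : t ≤ N + 3) :
    k * t < 2 ^ (b - 1) :=
  (Nat.mul_le_mul hk ht).trans_lt h.lt

theorem closure_gens {S : NumericalSemigroup} {A : List ℕ} (hA : gens A ⊆ S.primitives)
    (h : S.primitives ⊆ gens A) : AddSubmonoid.closure (gens A) = S.toAddSubmonoid := by
  rw [Set.Subset.antisymm hA h, closure_primitives]

theorem leafTest_sound {S : NumericalSemigroup} (h60 : ∀ p ∈ S.primitives, p ≤ 60)
    (h1 : 1 ∉ S.toAddSubmonoid) {b N m j : ℕ} (L : Lanes b N m j) {A : List ℕ} (hnd : A.Nodup)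
    (hA : gens A ⊆ S.primitives) (hA' : S.primitives ⊆ gens A) (hmA : m ∈ A)
    (h : leafTest (ones b (N + 1)) (Nat.shiftLeft (ones b (N + 1)) (Nat.sub b 1))
      (offset b N (ones b (N + 1))) (lowLanes b (m + 1)) A.length
      (laneSet b N (AddSubmonoid.closure (gens A)))
      (prefixLanes (ones b (N + 1)) (b * (N + 1))
        (laneSet b N (AddSubmonoid.closure (gens A)))) = true) : S.SatisfiesWilf := by
  have hb := L.pos
  have hlt := L.lt_two_pow
  have hlt1 := L.lt
  have he : S.embeddingDimension = A.length := by
    rw [embeddingDimension_eq hnd hA, Set.sdiff_eq_empty.2 hA']; simp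
  have hk : A.length ≤ 60 := he ▸ embeddingDimension_le h60
  rw [prefixLanes_laneSet hb (by omega)] at h
  rw [closure_gens hA hA'] at h
  set T : Set ℕ := (S.toAddSubmonoid : Set ℕ) with hT
  have h0 := (Nat.eq_of_beq_eq_true h).symm
  have pass : ∀ x ≤ N, 0 < x → (Nat.lor (lowMask (Nat.xor (ones b (N + 1)) (laneSet b N T)))
      (lowLanes b (m + 1))).testBit (b * (N - x) + (b - 1)) = true →
      x ≤ A.length * cnt T x := by
    intro x hx hx0 hbit
    by_contra hcon
    have hf := (testBit_failLanes hb (k := A.length) (p := fun i => cnt T (N - i))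
      (N := N) (by omega) (fun i _ => L.mul_lt (by omega)
        ((cnt_le _ _).trans (by omega))) (b * (N - x) + (b - 1))).2
      ⟨N - x, by omega, rfl, by rw [Nat.sub_sub_self hx]; omega⟩
    have := congrArg (fun z => z.testBit (b * (N - x) + (b - 1))) h0
    simp only [Nat.zero_testBit] at this
    change ((_ &&& _ : ℕ)).testBit _ = false at this
    rw [Nat.testBit_and, hf, hbit] at this
    simp at this
  have low : ∀ i ≤ m, (lowLanes b (m + 1)).testBit (b * i + (b - 1)) = true := by
    intro i hi
    have := Nat.mul_le_mul_left b hi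
    rw [testBit_lowLanes, decide_eq_true_iff, Nat.mul_succ]
    omega
  refine satisfiesWilf_of_dense le_rfl h1 L.mpos ?_ L.eq L.jpos he.ge (fun x hx hxN => ?_)
    (fun F hF hFN => ?_)
  · rw [← closure_gens hA hA']
    exact AddSubmonoid.subset_closure hmA
  -- The lane of x = 0 always fails by construction, but the bound is trivial there.
  · rcases Nat.eq_zero_or_pos x with rfl | hx0
    · exact Nat.zero_le _
    refine pass x hxN hx0 ?_
    change (_ ||| _ : ℕ).testBit _ = true
    rw [Nat.testBit_or, low _ (by omega), Bool.or_true]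
  · refine pass (F + 1) hFN (by omega) ?_
    change (_ ||| _ : ℕ).testBit _ = true
    rw [Nat.testBit_or, Bool.or_eq_true]
    left
    -- The bits of this number are the gaps up to N. In the reversed order its lowest bit is the
    -- largest gap, so `lowMask` reaches past the whole lane of F + 1.
    have hbits : ∀ p, (Nat.xor (ones b (N + 1)) (laneSet b N T)).testBit p = true ↔
        ∃ x ≤ N, x ∉ T ∧ p = b * (N - x) := by
      intro p
      change (_ ^^^ _ : ℕ).testBit _ = true ↔ _
      rw [Nat.testBit_xor, ones_eq_laneSet hb]
      constructor
      · intro hx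
        have hu : (laneSet b N Set.univ).testBit p = true := by
          by_contra hu
          have hu' : ¬ (laneSet b N T).testBit p = true := fun hc => hu (by
            rw [testBit_laneSet hb] at hc ⊢
            obtain ⟨x, hx, -, hp⟩ := hc
            exact ⟨x, hx, trivial, hp⟩)
          simp [hu, hu'] at hx
        obtain ⟨x, hxN, -, rfl⟩ := (testBit_laneSet hb _ _ _).1 hu
        refine ⟨x, hxN, fun hxT => ?_, rfl⟩
        rw [hu, (laneSet_testBit_mul hb hxN T).2 hxT] at hx
        simp at hx
      · rintro ⟨x, hxN, hxT, rfl⟩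
        rw [(laneSet_testBit_mul hb hxN _).2 (Set.mem_univ _),
          Bool.eq_false_iff.2 (mt (laneSet_testBit_mul hb hxN T).1 hxT)]
        rfl
    have hne : Nat.xor (ones b (N + 1)) (laneSet b N T) ≠ 0 := fun hc => by
      have := (hbits (b * (N - F))).2 ⟨F, by omega, hF.1, rfl⟩
      rw [hc] at this
      simp at this
    obtain ⟨p, hp, -, hpm⟩ := exists_lowMask hne
    obtain ⟨x, hxN, hxT, rfl⟩ := (hbits p).1 hp
    have hxF : x ≤ F := by
      by_contra hc
      exact hxT (hF.2 x (by omega))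
    have := Nat.mul_le_mul_left b (show N - (F + 1) + 1 ≤ N - x by omega)
    rw [Nat.mul_succ] at this
    rw [hpm, Nat.testBit_two_pow_sub_one, decide_eq_true_iff]
    omega

theorem genLanes_eq {b d N : ℕ} (hb : 0 < b) {A : List ℕ} (hA : ∀ g ∈ A, N < 2 ^ (d + 4) * g) :
    genLanes b d N A = laneSet b N (AddSubmonoid.closure (gens A)) := by
  induction A with
  | nil =>
    refine laneSet_ext hb fun p => ?_
    change (2 ^ (b * N)).testBit p = true ↔ _
    have : gens [] = ∅ := by ext; simp [gens]
    rw [this, AddSubmonoid.closure_empty, Nat.testBit_two_pow]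
    simp [eq_comm]
  | cons g A ih =>
    have ih := ih fun g hg => hA g (List.mem_cons_of_mem _ hg)
    change shiftDown d (Nat.mul b g) (genLanes b d N A) = _
    rw [ih, shiftDown_laneSet hb (hA g List.mem_cons_self), gens_cons]

/-- The greatest common divisor divides all of S, which contains two consecutive integers. -/
theorem gcd_gens {S : NumericalSemigroup} {A : List ℕ} (hA : S.primitives ⊆ gens A) :
    List.foldr Nat.gcd 0 A = 1 := by
  set d := List.foldr Nat.gcd 0 A with hd
  have hdvd : ∀ a ∈ A, d ∣ a := by
    rw [hd]
    clear hA hd d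
    induction A with
    | nil => simp
    | cons g A ih =>
      intro a ha
      rw [List.foldr_cons]
      rcases List.mem_cons.1 ha with rfl | ha
      · exact Nat.gcd_dvd_left _ _
      · exact (Nat.gcd_dvd_right _ _).trans (ih a ha)
  have hS : ∀ x ∈ S.toAddSubmonoid, d ∣ x := by
    intro x hx
    rw [← closure_primitives] at hx
    induction hx using AddSubmonoid.closure_induction with
    | mem x hx => exact hdvd x (hA hx)
    | zero => exact dvd_zero d
    | add a b _ _ ha hb => exact dvd_add ha hb
  obtain ⟨N, hN⟩ := S.exists_bound
  have h1 := hS (N + 1) (hN _ (by omega))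
  have h2 := hS (N + 1 + 1) (hN _ (by omega))
  exact Nat.dvd_one.1 ((Nat.dvd_add_right h1).1 h2)

theorem slowLeaf_sound {S : NumericalSemigroup} (h60 : ∀ p ∈ S.primitives, p ≤ 60)
    (h1 : 1 ∉ S.toAddSubmonoid) {m : ℕ} (hm : 0 < m) (hm60 : m ≤ 60) {A : List ℕ} (hnd : A.Nodup)
    (hA : gens A ⊆ S.primitives) (hA' : S.primitives ⊆ gens A) (hmA : m ∈ A)
    (h : slowLeaf m A.length A = true) : S.SatisfiesWilf := by
  rw [slowLeaf, boolRec_eq_true] at h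
  have hg := gcd_gens hA'
  rcases h with ⟨h, -⟩ | ⟨-, h⟩
  · have : (List.rec 0 (fun g _ ih => Nat.gcd g ih) A : ℕ) = List.foldr Nat.gcd 0 A := by
      clear * -
      induction A with
      | nil => rfl
      | cons g A ih => rw [List.foldr_cons, ← ih]
    rw [this, hg] at h
    simp [Nat.beq_refl] at h
  · set N := Nat.mul m (Nat.div 3600 m) with hN
    have hN' : N = 3600 / m * m := mul_comm _ _
    have hle : N ≤ 3600 := hN' ▸ Nat.div_mul_le_self _ _
    -- The width 19 suffices because 63 * 3603 < 2 ^ 18. The parameter 8 below gives 2 ^ 12 > 3600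
    -- translates, enough for any positive generator.
    have L : Lanes 19 N m (3600 / m) :=
      ⟨by norm_num, by norm_num; omega, hN', Nat.div_pos (by omega) hm, hm⟩
    refine leafTest_sound h60 h1 L hnd hA hA' hmA ?_
    rw [← genLanes_eq (d := 8) (by norm_num) (fun g hg => ?_)]
    · exact h
    · have := (mem_of_mem_primitives (hA hg)).2
      omega

/-! ### The pruning masks -/

theorem failMask_spec {b N m j : ℕ} (L : Lanes b N m j) (hmN : m + 61 ≤ N) {T : Set ℕ} {k r : ℕ}
    (hk : k + r ≤ 63) (hr : r ≤ 2) :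
    ∃ i ≤ N, lowMask (failLanes (Nat.shiftLeft (ones b (N + 1)) (Nat.sub b 1))
      (offset b N (ones b (N + 1))) (Nat.add k r)
      (Nat.add (prefixLanes (ones b (N + 1)) (b * (N + 1)) (laneSet b N T))
        (Nat.mul r (Nat.shiftLeft (ones b (Nat.sub N (Nat.add m 61)))
          (Nat.mul b (Nat.succ m)))))) = 2 ^ (b * (i + 1)) - 1 ∧
      ∀ x, N - i < x → x ≤ N →
        x ≤ (k + r) * (cnt T x + r * (if 60 < x ∧ x < N - m then 1 else 0)) := by
  have hb := L.pos
  have hlt := L.lt_two_pow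
  have hlt1 := L.lt
  -- Lanes m + 1, …, N - 61 are those of 61 ≤ x < N - m, where the bonus for further primitives
  -- applies.
  have hI : Nat.shiftLeft (ones b (Nat.sub N (Nat.add m 61))) (Nat.mul b (Nat.succ m)) =
      pack b (N + 1) (fun i => if 60 < N - i ∧ N - i < N - m then 1 else 0) := by
    change (ones b (N - (m + 61))) <<< (b * (m + 1)) = _
    rw [Nat.shiftLeft_eq, ones_eq_pack hb, pack, pack, Finset.sum_mul]
    simp only [ite_mul, one_mul, zero_mul]
    rw [← Finset.sum_filter]
    refine Finset.sum_bij' (fun i _ => i + (m + 1)) (fun i _ => i - (m + 1)) ?_ ?_ ?_ ?_ ?_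
    · intro i hi; simp at hi ⊢; omega
    · intro i hi; simp at hi ⊢; omega
    · intro i hi; simp
    · intro i hi; simp at hi ⊢; omega
    · intro i hi; rw [← pow_add, ← Nat.mul_add]
  have hP : Nat.add (prefixLanes (ones b (N + 1)) (b * (N + 1)) (laneSet b N T))
        (Nat.mul r (Nat.shiftLeft (ones b (Nat.sub N (Nat.add m 61)))
          (Nat.mul b (Nat.succ m)))) = pack b (N + 1) (fun i => cnt T (N - i) +
            r * (if 60 < N - i ∧ N - i < N - m then 1 else 0)) := by
    change _ + r * _ = _
    rw [hI, prefixLanes_laneSet hb (by omega), pack_mul, pack_add]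
  rw [hP]
  set p : ℕ → ℕ := fun i => cnt T (N - i) +
            r * (if 60 < N - i ∧ N - i < N - m then 1 else 0) with hp
  have hp' : ∀ i, p i ≤ N + 2 := fun i => by
    have := cnt_le T (N - i)
    simp only [hp]
    split_ifs <;> omega
  have bit := testBit_failLanes hb (k := k + r) (p := p) (N := N) (by omega)
    (fun i _ => L.mul_lt hk ((hp' i).trans (by omega)))
  have hne : failLanes (Nat.shiftLeft (ones b (N + 1)) (Nat.sub b 1))
      (offset b N (ones b (N + 1))) (k + r) (pack b (N + 1) p) ≠ 0 := fun hc => by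
    have := (bit (b * N + (b - 1))).2 ⟨N, le_rfl, rfl, by simp [hp, cnt_zero]⟩
    rw [hc] at this
    simp at this
  -- The lowest failing lane i belongs to the largest x at which the bound fails, so the bound holds
  -- above N - i.
  obtain ⟨q, hq, hlow, hmask⟩ := exists_lowMask hne
  obtain ⟨i, hi, rfl, -⟩ := (bit q).1 hq
  refine ⟨i, hi, ?_, fun x hx hxN => ?_⟩
  · change lowMask (failLanes _ _ (k + r) _) = _
    rw [hmask, Nat.mul_succ]
    congr 2
    omega
  · by_contra hcon
    have h1 := hlow (b * (N - x) + (b - 1)) (by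
      have := Nat.mul_le_mul_left b (show N - x + 1 ≤ i by omega)
      rw [Nat.mul_succ] at this
      omega)
    have h2 := (bit (b * (N - x) + (b - 1))).2 ⟨N - x, by omega, rfl, by
      simp only [hp]
      rw [Nat.sub_sub_self hxN]
      omega⟩
    rw [h1] at h2
    simp at h2

/-- The mask consists of the bits N - i, …, W - 1. It is 0 when W ≤ N - i, and then nothing is
pruned. -/
theorem exists_of_topMask {b N W i Z : ℕ} (hi : i ≤ N) (hN : N + 1 < 2 ^ b - 1)
    (h : Nat.beq (Nat.land Z (Nat.sub (2 ^ W) (Nat.shiftLeft 1 (Nat.sub (N + 1)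
      (Nat.div (Nat.mod (2 ^ (b * (i + 1)) - 1) ((2 ^ b - 1) ^ 2)) (2 ^ b - 1))))))
      (Nat.sub (2 ^ W) (Nat.shiftLeft 1 (Nat.sub (N + 1)
      (Nat.div (Nat.mod (2 ^ (b * (i + 1)) - 1) ((2 ^ b - 1) ^ 2)) (2 ^ b - 1))))) = false) :
    ∃ y, N - i ≤ y ∧ y < W ∧ Z.testBit y = false := by
  obtain ⟨y, hK, hZ⟩ := exists_of_land_ne h
  have e : Nat.div (Nat.mod (2 ^ (b * (i + 1)) - 1) ((2 ^ b - 1) ^ 2)) (2 ^ b - 1) = i + 1 :=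
    mask_mod_div (by omega)
  rw [e] at hK
  have := testBit_sub_shiftLeft hK
  have h2 : Nat.sub (N + 1) (i + 1) = N - i := Nat.add_sub_add_right N 1 i
  rw [h2] at this
  exact ⟨y, this.1, this.2, hZ⟩

/-- The mask keeps the lanes m + 1, …, i, that is N - i ≤ x < N - m. A missing element shows that it
is nonempty, whence N - i < N - m. -/
theorem exists_of_laneMask {b N m i : ℕ} {T : Set ℕ} (hb : 0 < b) (hiN : i ≤ N)
    (h : Nat.beq (Nat.land (laneSet b N T) (Nat.land (ones b (N + 1))
      (Nat.sub (2 ^ (b * (i + 1)) - 1) (lowLanes b (m + 1))))) (Nat.land (ones b (N + 1))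
      (Nat.sub (2 ^ (b * (i + 1)) - 1) (lowLanes b (m + 1)))) = false) :
    ∃ y, N - i ≤ y ∧ y ∉ T ∧ N - i < N - m := by
  obtain ⟨p, hK, hZ⟩ := exists_of_land_ne h
  change ((ones b (N + 1)) &&& ((2 ^ (b * (i + 1)) - 1) - (2 ^ (b * (m + 1)) - 1))).testBit p
    = true at hK
  rw [Nat.testBit_and, Bool.and_eq_true, ones_eq_laneSet hb, testBit_laneSet hb] at hK
  obtain ⟨⟨x, hx, -, rfl⟩, hK⟩ := hK
  have hxT : x ∉ T := fun hc => by
    rw [(laneSet_testBit_mul hb hx T).2 hc] at hZ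
    simp at hZ
  have hmi : m < i := by
    by_contra hcon
    rw [Nat.sub_eq_zero_of_le (Nat.sub_le_sub_right (Nat.pow_le_pow_right two_pos
      (Nat.mul_le_mul_left b (by omega))) 1)] at hK
    simp at hK
  have hlt : b * (N - x) < b * (i + 1) := by
    by_contra hcon
    rw [Nat.testBit_lt_two_pow] at hK
    · simp at hK
    · have : 0 < 2 ^ (b * (i + 1)) := by positivity
      have := Nat.pow_le_pow_right two_pos (not_lt.1 hcon)
      omega
  have := Nat.lt_of_mul_lt_mul_left hlt
  exact ⟨x, by omega, hxT, by omega⟩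

/-! ### Correctness of the search -/

/-- The submonoid generated by `A` and all integers from `q` to `60`. -/
def upper (A : List ℕ) (q : ℕ) : AddSubmonoid ℕ := AddSubmonoid.closure (gens A ∪ Set.Icc q 60)

theorem le_upper {S : NumericalSemigroup} (h60 : ∀ p ∈ S.primitives, p ≤ 60) {A : List ℕ} {q : ℕ}
    (h : ∀ p ∈ S.primitives, p ∈ A ∨ q ≤ p) : S.toAddSubmonoid ≤ upper A q := by
  rw [← closure_primitives]
  exact AddSubmonoid.closure_mono fun p hp => (h p hp).imp id fun h => ⟨h, h60 p hp⟩

theorem upper_cons (A : List ℕ) (q q' : ℕ) :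
    (upper (q :: A) q' : Set ℕ) = {y | ∃ i, ∃ t ∈ (upper A q' : Set ℕ), y = t + i * q} := by
  ext y
  rw [upper, gens_cons, Set.insert_union]
  exact mem_closure_insert

theorem Covers.shiftRight {W n Z : ℕ} {U : ℕ → Set ℕ} (h : Covers W (n + 1) Z U) :
    Covers W n (Nat.shiftRight Z W) (fun j => U (j + 1)) := by
  intro j hj y hy hyU
  change (Z >>> W).testBit _ = true
  rw [Nat.testBit_shiftRight, ← add_assoc, add_comm W, ← Nat.mul_succ]
  exact h (j + 1) (by omega) y hy hyU

/-- `f` verifies Wilf's inequality for every semigroup whose smallest primitives are the elements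
of the list `q :: A` (largest first), with at least one primitive above `q`. -/
def Sound (S : NumericalSemigroup) (b N W m : ℕ) (f : List ℕ → ℕ → ℕ → ℕ → ℕ → Bool) : Prop :=
  ∀ A q V, (q :: A).Nodup → gens (q :: A) ⊆ S.primitives → m ∈ q :: A →
    (∀ p ∈ S.primitives, p ∈ q :: A ∨ q < p) → (∃ p ∈ S.primitives, p ∉ q :: A) →
    Covers W (61 - q) V (fun j => upper A (q + j)) →
    f (q :: A) (A.length + 1) (laneSet b N (AddSubmonoid.closure (gens (q :: A)))) V q = true →
    S.SatisfiesWilf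

/-- Here s is the true next primitive. Candidates q < s are passed over, or the scan stops early: as
S is contained in `upper A q` for every q ≤ s, a gap seen at such a q is already a gap of S. At q =
s either s is the last primitive, or two primitives are missing from A and the bound with r = 2
applies. -/
theorem scan_sound {S : NumericalSemigroup} (h60 : ∀ p ∈ S.primitives, p ≤ 60)
    (h1 : 1 ∉ S.toAddSubmonoid) {b N W m j : ℕ} (L : Lanes b N m j) (hW : W + m ≤ N)
    {A : List ℕ} (hnd : A.Nodup) (hA : gens A ⊆ S.primitives) (hmA : m ∈ A)
    {s : ℕ} (hs : s ∈ S.primitives) (hsA : s ∉ A) (hleast : ∀ p ∈ S.primitives, p ∈ A ∨ s ≤ p)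
    {mem : ℕ → ℕ → Bool} {aT : ℕ → ℕ → ℕ} {leaf : ℕ → List ℕ → ℕ → Bool}
    {ih : List ℕ → ℕ → ℕ → ℕ → ℕ → Bool} {K₁ K₂ KT : ℕ}
    (hmem : mem s (laneSet b N (AddSubmonoid.closure (gens A))) = true →
      s ∈ AddSubmonoid.closure (gens A))
    (haT : aT s (laneSet b N (AddSubmonoid.closure (gens A))) =
      laneSet b N (AddSubmonoid.closure (gens (s :: A))))
    (hleaf : S.primitives ⊆ gens (s :: A) → leaf (A.length + 1) (s :: A)
      (laneSet b N (AddSubmonoid.closure (gens (s :: A)))) = true → S.SatisfiesWilf)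
    (hih : Sound S b N W m ih) {i₁ i₂ : ℕ}
    (hb₁ : ∀ x, N - i₁ < x → x ≤ N → x ≤ (A.length + 1) *
      (cnt (AddSubmonoid.closure (gens A)) x + 1 * (if 60 < x ∧ x < N - m then 1 else 0)))
    (hb₂ : ∀ x, N - i₂ < x → x ≤ N → x ≤ (A.length + 2) *
      (cnt (AddSubmonoid.closure (gens A)) x + 2 * (if 60 < x ∧ x < N - m then 1 else 0)))
    (hK₁ : ∀ Z, Nat.beq (Nat.land Z K₁) K₁ = false →
      ∃ y, N - i₁ ≤ y ∧ y < W ∧ Z.testBit y = false)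
    (hK₂ : ∀ Z, Nat.beq (Nat.land Z K₂) K₂ = false →
      ∃ y, N - i₂ ≤ y ∧ y < W ∧ Z.testBit y = false)
    (hKT : ∀ T : Set ℕ, Nat.beq (Nat.land (laneSet b N T) KT) KT = false →
      ∃ y, N - i₁ ≤ y ∧ y ∉ T ∧ N - i₁ < N - m) :
    ∀ n q Z, q ≤ s → s < q + n → Covers W (61 - q) Z (fun j => upper A (q + j)) →
      scan W mem aT leaf ih A A.length (laneSet b N (AddSubmonoid.closure (gens A))) K₁ K₂ KT n q Z
        = true → S.SatisfiesWilf := by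
  have hs60 := h60 s hs
  have hone : 1 ≤ (S.primitives \ gens A).ncard := by
    rw [Nat.one_le_iff_ne_zero, ne_eq,
      Set.ncard_eq_zero ((primitives_finite S).subset Set.sdiff_subset)]
    exact Set.Nonempty.ne_empty ⟨s, hs, hsA⟩
  have miss : ∀ q Z, q ≤ s → Covers W (61 - q) Z (fun j => upper A (q + j)) →
      ∀ y < W, Z.testBit y = false → y ∉ S.toAddSubmonoid := by
    intro q Z hq hcov y hy hZ hyS
    have := hcov 0 (by omega) y hy
      (le_upper h60 (fun p hp => (hleast p hp).imp id hq.trans) hyS)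
    rw [mul_zero, zero_add, hZ] at this
    simp at this
  intro n
  induction n with
  | zero => intro q Z hq hqn; omega
  | succ n ihn =>
    intro q Z hq hqn hcov h
    set T := laneSet b N (AddSubmonoid.closure (gens A)) with hT
    change (Bool.rec true
      (Bool.rec false (scan W mem aT leaf ih A A.length T K₁ K₂ KT n (q + 1) (Nat.shiftRight Z W))
        (Bool.rec
          (Bool.rec false
              (Bool.rec true (ih (q :: A) (A.length + 1) (aT q T) Z q)
                (Nat.beq (Nat.land Z K₂) K₂))
              (Bool.rec true (leaf (A.length + 1) (q :: A) (aT q T))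
                (Nat.beq (Nat.land (aT q T) KT) KT)))
          true (mem q T)))
      (Nat.beq (Nat.land Z K₁) K₁) : Bool) = true at h
    rw [boolRec_eq_true] at h
    rcases h with ⟨h, -⟩ | ⟨-, h⟩
    · obtain ⟨y, hy, hyW, hZ⟩ := hK₁ Z h
      exact satisfiesWilf_of_bound h60 hnd hA hone L.mpos hmA L.eq L.jpos h1 (by omega) hb₁ hy
        (miss q Z hq hcov y hyW hZ)
    · rw [boolRec_eq_true] at h
      rcases h with ⟨-, h⟩ | ⟨hv, hn⟩
      · simp at h
      rcases hq.lt_or_eq with hlt | rfl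
      · refine ihn (q + 1) _ hlt (by omega) ?_ hn
        rw [show 61 - q = 61 - (q + 1) + 1 by omega] at hcov
        have := hcov.shiftRight
        simpa only [add_assoc, add_comm 1] using this
      · rw [boolRec_eq_true] at hv
        rcases hv with ⟨-, hv⟩ | ⟨hv, -⟩
        swap
        -- A candidate already generated by A cannot be the primitive s.
        · exact absurd (mem_of_mem_closure hA hs (hmem hv)) hsA
        rw [boolRec_eq_true, haT] at hv
        rcases hv with ⟨-, hv⟩ | ⟨hl, hr⟩
        · simp at hv
        have hA' : gens (q :: A) ⊆ S.primitives := by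
          rw [gens_cons]
          exact Set.insert_subset hs hA
        by_cases hall : S.primitives ⊆ gens (q :: A)
        · rw [boolRec_eq_true] at hl
          rcases hl with ⟨hl, -⟩ | ⟨-, hl⟩
          -- Now S is generated by q :: A, so an integer missing from that submonoid is a gap of S
          -- itself.
          · obtain ⟨y, hy, hyT, hlt⟩ := hKT _ hl
            rw [closure_gens hA' hall] at hyT
            exact satisfiesWilf_of_bound h60 hnd hA hone L.mpos hmA L.eq L.jpos h1 hlt hb₁ hy hyT
          · exact hleaf hall hl
        · obtain ⟨p, hp, hpA⟩ := Set.not_subset.1 hall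
          have hndq : (q :: A).Nodup := List.nodup_cons.2 ⟨hsA, hnd⟩
          rw [boolRec_eq_true] at hr
          rcases hr with ⟨hr, -⟩ | ⟨-, hr⟩
          · obtain ⟨y, hy, hyW, hZ⟩ := hK₂ Z hr
            refine satisfiesWilf_of_bound h60 hnd hA ?_ L.mpos hmA L.eq L.jpos h1 (by omega) hb₂
              hy (miss q Z le_rfl hcov y hyW hZ)
            have hpq : p ≠ q := fun h => hpA (h ▸ List.mem_cons_self)
            rw [← Set.ncard_pair hpq]
            refine Set.ncard_le_ncard ?_ ((primitives_finite S).subset Set.sdiff_subset)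
            rintro x (rfl | rfl)
            · exact ⟨hp, fun h => hpA (List.mem_cons_of_mem _ h)⟩
            · exact ⟨hs, hsA⟩
          · refine hih A q Z hndq hA' (List.mem_cons_of_mem _ hmA) (fun p hp => ?_) ⟨p, hp, hpA⟩
              hcov hr
            rcases hleast p hp with h | h
            · exact Or.inl (List.mem_cons_of_mem _ h)
            · rcases h.lt_or_eq with h | rfl
              · exact Or.inr h
              · exact Or.inl List.mem_cons_self

/-- `node` for the lane encoding, as used by `checkWith`. -/
noncomputable def laneNode (b d N W m : ℕ) (ih : List ℕ → ℕ → ℕ → ℕ → ℕ → Bool) (A : List ℕ)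
    (k T n q Z : ℕ) : Bool :=
  node W (fun T => prefixLanes (ones b (N + 1)) (b * (N + 1)) T)
    (fun k r P => lowMask (failLanes (Nat.shiftLeft (ones b (N + 1)) (Nat.sub b 1))
      (offset b N (ones b (N + 1))) (Nat.add k r) (Nat.add P (Nat.mul r
        (Nat.shiftLeft (ones b (Nat.sub N (Nat.add m 61))) (Nat.mul b (Nat.succ m)))))))
    (fun F => Nat.sub (2 ^ W) (Nat.shiftLeft 1 (Nat.sub (N + 1)
      (Nat.div (Nat.mod F ((2 ^ b - 1) ^ 2)) (2 ^ b - 1)))))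
    (fun F => Nat.land (ones b (N + 1)) (Nat.sub F (lowLanes b (m + 1))))
    (fun q T => Nat.beq 1 (Nat.land 1 (Nat.shiftRight T (Nat.mul b (Nat.sub N q)))))
    (fun q T => shiftDown d (Nat.mul b q) T)
    (fun k A T => Bool.rec (slowLeaf m k A) true
      (leafTest (ones b (N + 1)) (Nat.shiftLeft (ones b (N + 1)) (Nat.sub b 1))
        (offset b N (ones b (N + 1))) (lowLanes b (m + 1)) k T
        (prefixLanes (ones b (N + 1)) (b * (N + 1)) T)))
    ih A k T n q Z

/-- The abstractions in `checkWith` only share common values; β-reduction removes them. -/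
theorem checkWith_eq (b d N W m lo n : ℕ) : checkWith b d N W m lo n =
    laneNode b d N W m (search W
      (fun q V => shiftUp (ones W 61) (Nat.shiftLeft (ones W 61) W) W q V)
      (laneNode b d N W m) 60) [m] 1 (genLanes b d N [m]) n lo (rootBlocks W m (Nat.sub 61 lo)) :=
  rfl

theorem laneNode_sound {S : NumericalSemigroup} (h60 : ∀ p ∈ S.primitives, p ≤ 60)
    (h1 : 1 ∉ S.toAddSubmonoid) {b d N W m j : ℕ} (L : Lanes b N m j) (hW : W + m ≤ N)
    (hmN : m + 61 ≤ N) (hd : N < 2 ^ (d + 4) * m) (hm : ∀ p ∈ S.primitives, m ≤ p)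
    {A : List ℕ} (hnd : A.Nodup) (hA : gens A ⊆ S.primitives) (hmA : m ∈ A)
    {s : ℕ} (hs : s ∈ S.primitives) (hsA : s ∉ A) (hleast : ∀ p ∈ S.primitives, p ∈ A ∨ s ≤ p)
    {ih : List ℕ → ℕ → ℕ → ℕ → ℕ → Bool} (hih : Sound S b N W m ih) {n q Z : ℕ} (hq : q ≤ s)
    (hn : s < q + n) (hcov : Covers W (61 - q) Z (fun j => upper A (q + j)))
    (h : laneNode b d N W m ih A A.length (laneSet b N (AddSubmonoid.closure (gens A))) n q Z
      = true) : S.SatisfiesWilf := by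
  have hb := L.pos
  have hlt := L.lt_two_pow
  have hlen : A.length ≤ 60 := by
    have := embeddingDimension_eq hnd hA
    have := embeddingDimension_le h60
    omega
  have hndq : (s :: A).Nodup := List.nodup_cons.2 ⟨hsA, hnd⟩
  have hAs : gens (s :: A) ⊆ S.primitives := by
    rw [gens_cons]
    exact Set.insert_subset hs hA
  obtain ⟨i₁, hi₁, e₁, hb₁⟩ := failMask_spec L hmN
    (T := (AddSubmonoid.closure (gens A) : Set ℕ)) (k := A.length) (r := 1) (by omega) (by omega)
  obtain ⟨i₂, hi₂, e₂, hb₂⟩ := failMask_spec L hmN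
    (T := (AddSubmonoid.closure (gens A) : Set ℕ)) (k := A.length) (r := 2) (by omega) (by omega)
  simp only [laneNode, node] at h
  rw [e₁, e₂] at h
  refine scan_sound h60 h1 L hW hnd hA hmA hs hsA hleast ?_ ?_ ?_ hih hb₁ hb₂
    (fun Z hZ => exists_of_topMask hi₁ (by omega) hZ)
    (fun Z hZ => exists_of_topMask hi₂ (by omega) hZ)
    (fun T hT => exists_of_laneMask hb hi₁ hT) n q Z hq hn hcov h
  · intro h
    have := h60 s hs
    rw [← SetLike.mem_coe, ← laneSet_testBit_mul hb (show s ≤ N by omega)]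
    have h' := Nat.eq_of_beq_eq_true h
    change 1 = 1 &&& (_ >>> (b * (N - s))) at h'
    rw [Nat.testBit, ← h']
    rfl
  · rw [gens_cons]
    exact shiftDown_laneSet hb (hd.trans_le (Nat.mul_le_mul_left _ (hm s hs))) _
  · intro hall h
    rw [boolRec_eq_true] at h
    rcases h with ⟨-, h⟩ | ⟨h, -⟩
    · exact slowLeaf_sound h60 h1 L.mpos (h60 m (hA hmA)) hndq hAs hall
        (List.mem_cons_of_mem _ hmA) h
    · exact leafTest_sound h60 h1 L hndq hAs hall (List.mem_cons_of_mem _ hmA) h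

theorem exists_least {S : NumericalSemigroup} {A : List ℕ} (h : ∃ p ∈ S.primitives, p ∉ A) :
    ∃ s ∈ S.primitives, s ∉ A ∧ ∀ p ∈ S.primitives, p ∈ A ∨ s ≤ p := by
  classical
  refine ⟨Nat.find h, (Nat.find_spec h).1, (Nat.find_spec h).2, fun p hp => ?_⟩
  by_cases hpA : p ∈ A
  · exact Or.inl hpA
  · exact Or.inr (Nat.find_min' h ⟨hp, hpA⟩)

theorem search_sound {S : NumericalSemigroup} (h60 : ∀ p ∈ S.primitives, p ≤ 60)
    (h1 : 1 ∉ S.toAddSubmonoid) {b d N W m j : ℕ} (L : Lanes b N m j) (hW0 : 0 < W)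
    (hW8 : W < 2 ^ 8) (hW : W + m ≤ N)
    (hmN : m + 61 ≤ N) (hd : N < 2 ^ (d + 4) * m) (hm : ∀ p ∈ S.primitives, m ≤ p) (fuel : ℕ) :
    Sound S b N W m
      (search W (fun q V => shiftUp (ones W 61) (Nat.shiftLeft (ones W 61) W) W q V)
        (laneNode b d N W m) fuel) := by
  induction fuel with
  | zero => intro A q V _ _ _ _ _ _ h; exact absurd h (by simp [search])
  | succ fuel ih =>
    intro A q V hnd hA hmA hgt hex hcov h
    obtain ⟨s, hs, hsA, hleast⟩ := exists_least hex
    have hqs : q < s := (hgt s hs).resolve_left hsA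
    have hs60 := h60 s hs
    have hq0 : 0 < q := L.mpos.trans_le (hm q (hA List.mem_cons_self))
    refine laneNode_sound h60 h1 L hW hmN hd hm hnd hA hmA hs hsA hleast ih (n := 60 - q)
      (q := q + 1) hqs (by omega) ?_ h
    -- Adding q to every block turns `upper A (q + j)` into `upper (q :: A) (q + j)`; dropping the
    -- lowest block then moves the start from q to q + 1.
    have hc := hcov.shiftUp (Q := 61) hW0 (by omega) hq0 (by nlinarith)
    rw [show 61 - q = 61 - (q + 1) + 1 by omega] at hc
    have hc' := hc.shiftRight
    intro i hi y hy hyU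
    refine hc' i hi y hy ?_
    change y ∈ (upper (q :: A) (q + 1 + i) : Set ℕ) at hyU
    rwa [add_assoc, add_comm 1, upper_cons] at hyU

/-! ### The blocks at the root of the search -/

theorem Covers.shiftUp_one {W : ℕ} (hW : 0 < W) {s A : ℕ} (hs : 0 < s) (hW8 : W < 2 ^ 8 * s)
    {U : ℕ → Set ℕ} (h : Covers W 1 A U) :
    Covers W 1 (WilfSearch.shiftUp 1 (Nat.pow 2 W) W s A)
      (fun j => {y | ∃ i, ∃ t ∈ U j, y = t + i * s}) := by
  have e : ones W 1 = 1 := by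
    rw [ones_eq_pack hW]
    simp [pack]
  have := h.shiftUp (Q := 1) hW le_rfl hs hW8
  rw [e, show Nat.shiftLeft 1 W = Nat.pow 2 W from Nat.one_shiftLeft W] at this
  exact this

theorem upper_eq_insert {A : List ℕ} {q : ℕ} (hq : q ≤ 60) :
    (upper A q : Set ℕ) = {y | ∃ i, ∃ t ∈ (upper A (q + 1) : Set ℕ), y = t + i * q} := by
  have : gens A ∪ Set.Icc q 60 = insert q (gens A ∪ Set.Icc (q + 1) 60) := by
    ext x
    simp only [Set.mem_union, Set.mem_Icc, Set.mem_insert_iff]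
    by_cases hx : x ∈ gens A
    · simp [hx]
    · simp only [hx, false_or]
      omega
  ext y
  rw [upper, this]
  exact mem_closure_insert

/-- Invariant: V covers the submonoid for q + 1, and U lists the blocks for q + 1, …, 60. Adding the
generator q to V gives the block to be put in front. -/
theorem rootBlocks_aux {W m : ℕ} (hW : 0 < W) (hW8 : W < 2 ^ 8) (n : ℕ) :
    ∀ q V U, n ≤ q → q ≤ 60 → Covers W 1 V (fun _ => upper [m] (q + 1)) →
      Covers W (60 - q) U (fun j => upper [m] (q + 1 + j)) →
      Covers W (60 - (q - n)) (Nat.rec (motive := fun _ => ℕ → ℕ → ℕ → ℕ) (fun _ _ U => U)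
        (fun _ ih q V U => (fun V' => ih (Nat.sub q 1) V' (Nat.lor V' (Nat.shiftLeft U W)))
          (shiftUp 1 (Nat.pow 2 W) W q V)) n q V U) (fun j => upper [m] (q - n + 1 + j)) := by
  induction n with
  | zero => intro q V U _ _ _ hU; exact hU
  | succ n ih =>
    intro q V U hn hq hV hU
    have hV' : Covers W 1 (shiftUp 1 (Nat.pow 2 W) W q V) (fun _ => upper [m] (q - 1 + 1)) := by
      have := hV.shiftUp_one hW (show 0 < q by omega) (by nlinarith)
      rw [show q - 1 + 1 = q by omega]
      simpa only [← upper_eq_insert hq] using this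
    rw [show q - (n + 1) = q - 1 - n by omega]
    refine ih (q - 1) _ _ (by omega) (by omega) hV' ?_
    intro i hi y hy hyU
    change (_ ||| (U <<< W)).testBit _ = true
    rw [Nat.testBit_or, Bool.or_eq_true]
    rcases i with _ | i
    · exact Or.inl (hV' 0 one_pos y hy hyU)
    · refine Or.inr ?_
      rw [Nat.testBit_shiftLeft, Bool.and_eq_true, decide_eq_true_eq, Nat.mul_succ]
      refine ⟨by omega, ?_⟩
      rw [show W * i + W + y - W = W * i + y by omega]
      refine hU i (by omega) y hy ?_
      change y ∈ (upper [m] (q + 1 + i) : Set ℕ)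
      rwa [show q + 1 + i = q - 1 + 1 + (i + 1) by omega]

theorem rootBlocks_covers {W m lo : ℕ} (hW : 0 < W) (hW8 : W < 2 ^ 8) (hm : 0 < m) (hlo : 0 < lo)
    (hlo' : lo ≤ 61) :
    Covers W (61 - lo) (rootBlocks W m (Nat.sub 61 lo)) (fun j => upper [m] (lo + j)) := by
  have hV : Covers W 1 (shiftUp 1 (Nat.pow 2 W) W m 1) (fun _ => upper [m] (60 + 1)) := by
    have h0 : Covers W 1 1 (fun _ => {0}) := by
      rintro i hi y hy rfl
      simp [Nat.lt_one_iff.1 hi]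
    have := h0.shiftUp_one hW hm (by nlinarith)
    intro i hi y hy hyU
    refine this i hi y hy ?_
    have hg : gens [m] ∪ Set.Icc (60 + 1) 60 = insert m ∅ := by
      ext x
      simp [gens]
    rw [upper, hg, SetLike.mem_coe, mem_closure_insert] at hyU
    simpa using hyU
  have := rootBlocks_aux hW hW8 (61 - lo) 60 _ 0 (by omega) le_rfl hV (fun i hi => by omega)
  rwa [show 60 - (61 - lo) = lo - 1 by omega, show 60 - (lo - 1) = 61 - lo by omega,
    show lo - 1 + 1 = lo by omega] at this

/-! ### From the computation to the theorem -/

theorem check_sound {S : NumericalSemigroup} (h60 : ∀ p ∈ S.primitives, p ≤ 60) {m lo n s : ℕ}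
    (hm2 : 2 ≤ m) (hmS : m ∈ S.primitives) (hm : ∀ p ∈ S.primitives, m ≤ p)
    (hs : s ∈ S.primitives) (hsm : s ≠ m) (hleast : ∀ p ∈ S.primitives, p ≠ m → s ≤ p)
    (hlo0 : 0 < lo) (hlo : lo ≤ s) (hn : s < lo + n) (h : check m lo n = true) :
    S.SatisfiesWilf := by
  have h1 : 1 ∉ S.toAddSubmonoid := fun h1 => by
    have : 1 ∈ S.primitives := S.mem_primitives_iff 1 |>.2 ⟨h1, one_ne_zero, fun a _ b _ h => by
      omega⟩
    have := hm 1 this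
    omega
  have hm60 := h60 m hmS
  set j := 192 / m + 2 with hj
  have hdiv : 192 < m * (192 / m + 1) := Nat.lt_mul_div_succ 192 (by omega)
  have hdiv' : m * (192 / m) ≤ 192 := Nat.mul_div_le 192 m
  have e : m * j = m * (192 / m) + 2 * m := by rw [hj]; ring
  have e' : m * (192 / m + 1) = m * (192 / m) + m := by ring
  -- With m ≤ 60, N = m * j is at most 192 + 120 = 312, and 63 * 315 < 2 ^ 15. Also N > 192 + m, so
  -- a full period fits above the blocks of 192 bits.
  have L : Lanes 16 (m * j) m j := ⟨by omega, by norm_num; omega, Nat.mul_comm _ _,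
    Nat.succ_pos _, by omega⟩
  have hd : m * j < 2 ^ (Nat.sub (Nat.succ (Nat.log2 j)) 4 + 4) * m := by
    rw [Nat.mul_comm]
    refine Nat.mul_lt_mul_of_pos_right ?_ (by omega)
    refine (Nat.lt_log2_self (n := j)).trans_le (Nat.pow_le_pow_right two_pos ?_)
    change _ ≤ Nat.succ _ - 4 + 4
    omega
  have hs60 := h60 s hs
  change checkWith 16 (Nat.sub (Nat.succ (Nat.log2 j)) 4) (m * j) 192 m lo n = true at h
  rw [checkWith_eq, genLanes_eq (by omega) (by simpa using hd)] at h
  exact laneNode_sound h60 h1 L (by omega) (by omega) hd hm (List.nodup_singleton m)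
    (by rintro x hx; rw [List.mem_singleton.1 hx]; exact hmS) List.mem_cons_self hs (by simpa)
    (fun p hp => by simpa [or_iff_not_imp_left] using hleast p hp)
    (search_sound h60 h1 L (by omega) (by norm_num) (by omega) (by omega) hd hm 60) hlo hn
    (rootBlocks_covers (by omega) (by norm_num) (by omega) hlo0 (by omega)) h

theorem check_2 : check 2 3 58 = true := by decide +kernel
theorem check_3 : check 3 4 57 = true := by decide +kernel
theorem check_4 : check 4 5 56 = true := by decide +kernel
theorem check_5 : check 5 6 55 = true := by decide +kernel
theorem check_6 : check 6 7 54 = true := by decide +kernel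
theorem check_7 : check 7 8 53 = true := by decide +kernel
theorem check_8 : check 8 9 52 = true := by decide +kernel
theorem check_9 : check 9 10 51 = true := by decide +kernel
theorem check_10 : check 10 11 50 = true := by decide +kernel
theorem check_11 : check 11 12 49 = true := by decide +kernel
theorem check_12 : check 12 13 48 = true := by decide +kernel
theorem check_13 : check 13 14 47 = true := by decide +kernel
theorem check_14 : check 14 15 46 = true := by decide +kernel
theorem check_15 : check 15 16 45 = true := by decide +kernel
theorem check_16 : check 16 17 44 = true := by decide +kernel
theorem check_17 : check 17 18 43 = true := by decide +kernel
theorem check_18 : check 18 19 42 = true := by decide +kernel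
theorem check_19 : check 19 20 41 = true := by decide +kernel
theorem check_20 : check 20 21 40 = true := by decide +kernel
theorem check_21 : check 21 22 39 = true := by decide +kernel
theorem check_22 : check 22 23 38 = true := by decide +kernel
theorem check_23 : check 23 24 37 = true := by decide +kernel
theorem check_24 : check 24 25 36 = true := by decide +kernel
theorem check_25 : check 25 26 35 = true := by decide +kernel
theorem check_26 : check 26 27 34 = true := by decide +kernel
theorem check_27 : check 27 28 33 = true := by decide +kernel
theorem check_28 : check 28 29 32 = true := by decide +kernel
theorem check_29 : check 29 30 31 = true := by decide +kernel
theorem check_30 : check 30 31 30 = true := by decide +kernel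
theorem check_31 : check 31 32 29 = true := by decide +kernel
theorem check_32 : check 32 33 28 = true := by decide +kernel
theorem check_33 : check 33 34 27 = true := by decide +kernel
theorem check_34 : check 34 35 26 = true := by decide +kernel
theorem check_35 : check 35 36 25 = true := by decide +kernel
theorem check_36 : check 36 37 24 = true := by decide +kernel
theorem check_37 : check 37 38 23 = true := by decide +kernel
theorem check_38 : check 38 39 22 = true := by decide +kernel
theorem check_39 : check 39 40 21 = true := by decide +kernel
theorem check_40 : check 40 41 20 = true := by decide +kernel
theorem check_41 : check 41 42 19 = true := by decide +kernel
theorem check_42 : check 42 43 18 = true := by decide +kernel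
theorem check_43 : check 43 44 17 = true := by decide +kernel
theorem check_44 : check 44 45 16 = true := by decide +kernel
theorem check_45 : check 45 46 15 = true := by decide +kernel
theorem check_46 : check 46 47 14 = true := by decide +kernel
theorem check_47 : check 47 48 13 = true := by decide +kernel
theorem check_48 : check 48 49 12 = true := by decide +kernel
theorem check_49 : check 49 50 11 = true := by decide +kernel
theorem check_50 : check 50 51 10 = true := by decide +kernel
theorem check_51 : check 51 52 9 = true := by decide +kernel
theorem check_52 : check 52 53 8 = true := by decide +kernel
theorem check_53 : check 53 54 7 = true := by decide +kernel
theorem check_54 : check 54 55 6 = true := by decide +kernel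
theorem check_55 : check 55 56 5 = true := by decide +kernel
theorem check_56 : check 56 57 4 = true := by decide +kernel
theorem check_57 : check 57 58 3 = true := by decide +kernel
theorem check_58 : check 58 59 2 = true := by decide +kernel
theorem check_59 : check 59 60 1 = true := by decide +kernel

/-- The value m = 60 does not occur, since a second primitive must lie in (m, 60]. -/
theorem check_eq_true {m : ℕ} (h : 2 ≤ m) (h' : m ≤ 59) : check m (m + 1) (60 - m) = true := by
  interval_cases m
  exacts [
    check_2, check_3, check_4, check_5, check_6, check_7, check_8, check_9, check_10, check_11,
    check_12, check_13, check_14, check_15, check_16, check_17, check_18, check_19, check_20,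
    check_21, check_22, check_23, check_24, check_25, check_26, check_27, check_28, check_29,
    check_30, check_31, check_32, check_33, check_34, check_35, check_36, check_37, check_38,
    check_39, check_40, check_41, check_42, check_43, check_44, check_45, check_46, check_47,
    check_48, check_49, check_50, check_51, check_52, check_53, check_54, check_55, check_56,
    check_57, check_58, check_59]

theorem satisfiesWilf_of_one_mem {S : NumericalSemigroup} (h : 1 ∈ S.toAddSubmonoid) :
    S.SatisfiesWilf := by
  have hF : S.frobenius < 0 := by
    by_contra hF
    have : S.frobenius.toNat ∈ S.toAddSubmonoid := by
      simpa using AddSubmonoid.nsmul_mem _ h S.frobenius.toNat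
    exact S.isGreatest_frobenius.1 _ this (by omega)
  have : (0 : ℤ) ≤ S.embeddingDimension * S.numLeft := by positivity
  rw [SatisfiesWilf, NumericalSemigroup.conductor]
  omega

theorem satisfiesWilf_of_primitives_le {S : NumericalSemigroup}
    (h60 : ∀ p ∈ S.primitives, p ≤ 60) : S.SatisfiesWilf := by
  by_cases h1 : 1 ∈ S.toAddSubmonoid
  · exact satisfiesWilf_of_one_mem h1
  -- A single primitive would have to equal its greatest common divisor 1, but 1 is not in S.
  have second : ∀ m ∈ S.primitives, ∃ p ∈ S.primitives, p ∉ [m] := fun m hm => by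
    by_contra! hcon
    have := gcd_gens (A := [m]) hcon
    rw [List.foldr_cons, List.foldr_nil, Nat.gcd_zero_right] at this
    exact h1 (this ▸ (mem_of_mem_primitives hm).1)
  have first : ∃ p ∈ S.primitives, p ∉ [] := by
    by_contra! hcon
    exact zero_ne_one (gcd_gens (A := []) hcon)
  obtain ⟨m, hm, -, hleast⟩ := exists_least first
  have hm' : ∀ p ∈ S.primitives, m ≤ p := fun p hp => by simpa using hleast p hp
  obtain ⟨s, hs, hsm, hs'⟩ := exists_least (second m hm)
  rw [List.mem_singleton] at hsm
  have hm0 := (mem_of_mem_primitives hm).2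
  have hm1 : m ≠ 1 := fun h => h1 (h ▸ (mem_of_mem_primitives hm).1)
  have hms := hm' s hs
  have hs60 := h60 s hs
  exact check_sound h60 (lo := m + 1) (n := 60 - m) (by omega) hm hm' hs hsm
    (fun p hp hpm => (hs' p hp).resolve_left (by simpa using hpm)) (by omega) (by omega)
    (by omega) (check_eq_true (by omega) (by omega))

end WilfSearch

theorem mainTheorem1 (n : ℕ) (hn : 0 < n) (hn60 : n ≤ 60) :
    ∀ S ∈ NumericalSemigroup.withMaxPrimitive n, S.SatisfiesWilf :=
  fun _ hS => WilfSearch.satisfiesWilf_of_primitives_le fun _ hp => (hS.2 hp).trans hn60
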